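/- Let $n\ge 3$ and $2<r<n$ be integers. Let $J_1,\dots,J_n\subset\mathbb R$ be nonempty open intervals, let $f_i:J_i\to\mathbb R$ be smooth functions, and let $M^n\subset\mathbb R^{n+1}$ be the translation hypersurface given by them, that is, the graph of $(x_1,\dots,x_n)\mapsto f_1(x_1)+\cdots+f_n(x_n)$ over $J_1\times\cdots\times J_n$. Let $S_r$ denote the $r$-th elementary symmetric function of the principal curvatures of $M$ (the eigenvalues of its shape operator with respect to a unit normal field). Then $S_r\equiv 0$ on $M$ if and only if $M$ is congruent (by an isometry of $\mathbb R^{n+1}$) to the graph, over a product $K_1\times\cdots\times K_n$ of nonempty open intervals, of a function of one of the following two kinds. 1. (Vertical cylinder) $$F(x_1,\dots,x_n)=\sum_{i=1}^{n-r+1}a_ix_i+\sum_{j=n-r+2}^{n}g_j(x_j)+b,$$ where $a_i,b\in\mathbb R$ and $g_j:K_j\to\mathbb R$ are arbitrary smooth functions. 2. (Generalized periodic Enneper hypersurface) $$F(x_1,\dots,x_n)=\sum_{i=1}^{n-r-1}a_ix_i+\sum_{k=n-r}^{n-1}\frac1{a_k}\ln\left|\frac{\cos\left(-\dfrac{a_{n-r}\cdots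 a_{n-1}}{\sigma_{r-1}(a_{n-r},\dots,a_{n-1})}\sqrt\beta\,x_n+b_n\right)}{\cos\left(a_k\sqrt\beta\,x_k+b_k\right)}\right|+c,$$ where $a_1,\dots,a_{n-1},b_{n-r},\dots,b_n,c$ are real constants, $\sigma_{r-1}$ is the elementary symmetric polynomial of degree $r-1$, the numbers $a_{n-r},\dots,a_{n-1}$ and $\sigma_{r-1}(a_{n-r},\dots,a_{n-1})$ are nonzero, $\beta=1+\sum_{i=1}^{n-r-1}a_i^2$, and where $K_k\subset I_k$ for $n-r\le k\le n$; here $I_k$ is, for $n-r\le k\le n-1$, the open interval defined by $|a_k\sqrt\beta\,x_k+b_k|<\pi/2$, and $I_n$ is the open interval defined by $\left|-\frac{a_{n-r}\cdots a_{n-1}}{\sigma_{r-1}(a_{n-r},\dots,a_{n-1})}\sqrt\beta\,x_n+b_n\right|<\pi/2$. -/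

import Mathlib

open scoped ContDiff

noncomputable section

namespace TranslationHypersurface

/-- Nonempty open intervals of the real line (bounded or not). -/
def IsOpenInterval (J : Set ℝ) : Prop := IsOpen J ∧ J.OrdConnected ∧ J.Nonempty

/-- The `i`-th partial derivative of a map on `ℝⁿ`. -/
def partialDeriv {n : ℕ} {E : Type*} [NormedAddCommGroup E] [NormedSpace ℝ E]
    (i : Fin n) (X : (Fin n → ℝ) → E) (x : Fin n → ℝ) : E :=
  fderiv ℝ X x (Pi.single i 1)

/-- First fundamental form of a parametrized hypersurface, in coordinates. -/
def firstForm {n : ℕ} (X : (Fin n → ℝ) → EuclideanSpace ℝ (Fin (n + 1))) (x : Fin n → ℝ) :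
    Matrix (Fin n) (Fin n) ℝ :=
  Matrix.of fun i j => inner ℝ (partialDeriv i X x) (partialDeriv j X x)

/-- Second fundamental form of a parametrized hypersurface with unit normal field `N`,
in coordinates. -/
def secondForm {n : ℕ} (X N : (Fin n → ℝ) → EuclideanSpace ℝ (Fin (n + 1))) (x : Fin n → ℝ) :
    Matrix (Fin n) (Fin n) ℝ :=
  Matrix.of fun i j => inner ℝ (N x) (partialDeriv i (partialDeriv j X) x)

/-- Matrix of the shape operator in the coordinate basis of the tangent space. -/
def shapeMatrix {n : ℕ} (X N : (Fin n → ℝ) → EuclideanSpace ℝ (Fin (n + 1))) (x : Fin n → ℝ) :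
    Matrix (Fin n) (Fin n) ℝ :=
  (firstForm X x)⁻¹ * secondForm X N x

/-- The `r`-th curvature `S_r` (for `r ≤ n`): the `r`-th elementary symmetric function of the
eigenvalues of the shape operator `A`, read off from
`det (t I - A) = ∑ k ≤ n, (-1) ^ k * S_k * t ^ (n - k)`. -/
def curvature {n : ℕ} (r : ℕ) (X N : (Fin n → ℝ) → EuclideanSpace ℝ (Fin (n + 1)))
    (x : Fin n → ℝ) : ℝ :=
  (-1) ^ r * (shapeMatrix X N x).charpoly.coeff (n - r)

/-- The parametrization `x ↦ (x, F x)` of the graph of `F`. -/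
def graphParam {n : ℕ} (F : (Fin n → ℝ) → ℝ) (x : Fin n → ℝ) : EuclideanSpace ℝ (Fin (n + 1)) :=
  WithLp.toLp 2 (Fin.snoc (α := fun _ => ℝ) x (F x))

/-- The upward unit normal `(-∇F, 1) / √(1 + |∇F|²)` of the graph of `F`. -/
def graphNormal {n : ℕ} (F : (Fin n → ℝ) → ℝ) (x : Fin n → ℝ) : EuclideanSpace ℝ (Fin (n + 1)) :=
  (√(1 + ∑ i, partialDeriv i F x ^ 2))⁻¹ •
    WithLp.toLp 2 (Fin.snoc (α := fun _ => ℝ) (fun i => -partialDeriv i F x) 1)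

/-- The `r`-th curvature of the graph of `F` at the point over `x`. -/
def graphCurvature {n : ℕ} (r : ℕ) (F : (Fin n → ℝ) → ℝ) (x : Fin n → ℝ) : ℝ :=
  curvature r (graphParam F) (graphNormal F) x

/-- The graph of `F` over `Ω`, as a subset of `ℝⁿ⁺¹`. -/
def graphOver {n : ℕ} (F : (Fin n → ℝ) → ℝ) (Ω : Set (Fin n → ℝ)) :
    Set (EuclideanSpace ℝ (Fin (n + 1))) :=
  graphParam F '' Ω

/-- Two subsets of `ℝᵐ` are congruent if a Euclidean isometry carries one onto the other. -/
def AreCongruent {m : ℕ} (M M' : Set (EuclideanSpace ℝ (Fin m))) : Prop :=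
  ∃ φ : EuclideanSpace ℝ (Fin m) ≃ᵢ EuclideanSpace ℝ (Fin m), φ '' M = M'

/-- `F (x₁, …, xₙ) = f₁ x₁ + ⋯ + fₙ xₙ`. -/
def translationFun {n : ℕ} (f : Fin n → ℝ → ℝ) (x : Fin n → ℝ) : ℝ := ∑ i, f i (x i)

/-- `a₁ x₁ + ⋯ + a_{n-r+1} x_{n-r+1} + f_{n-r+2} x_{n-r+2} + ⋯ + fₙ xₙ + b`.
Here and below the variable `x i` for `i : Fin n` is the one with number `i + 1`. -/
def cylinderFun {n : ℕ} (r : ℕ) (a : Fin n → ℝ) (f : Fin n → ℝ → ℝ) (b : ℝ) (x : Fin n → ℝ) : ℝ :=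
  ∑ i with i.val + r ≤ n, a i * x i + ∑ j with n < j.val + r, f j (x j) + b

/-- Graphs of `cylinderFun` over products of open intervals, the `f j` being smooth. -/
def IsCylinderGraph {n : ℕ} (r : ℕ) (M : Set (EuclideanSpace ℝ (Fin (n + 1)))) : Prop :=
  ∃ (K : Fin n → Set ℝ) (a : Fin n → ℝ) (f : Fin n → ℝ → ℝ) (b : ℝ),
    (∀ i, IsOpenInterval (K i)) ∧
    (∀ j : Fin n, n < j.val + r → ContDiffOn ℝ ∞ (f j) (K j)) ∧
    M = graphOver (cylinderFun r a f b) (Set.univ.pi K)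

/-- The (positions of the) variables with numbers `1, …, n - r - 1`. -/
def affineIdx (n r : ℕ) : Finset (Fin n) := {i | i.val + r + 1 < n}

/-- The (positions of the) variables with numbers `n - r, …, n - 1`. -/
def cosIdx (n r : ℕ) : Finset (Fin n) := {i | n ≤ i.val + 1 + r ∧ i.val + 1 < n}

/-- The position of the variable with number `n`. -/
def lastIdx {n r : ℕ} (h : r < n) : Fin n := ⟨n - 1, by omega⟩

/-- The `k`-th elementary symmetric polynomial of the numbers `a i`, `i ∈ s`. -/
def elemSymm {n : ℕ} (k : ℕ) (s : Finset (Fin n)) (a : Fin n → ℝ) : ℝ :=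
  ∑ t ∈ s.powersetCard k, ∏ i ∈ t, a i

/-- `β = 1 + a₁² + ⋯ + a_{n-r-1}²`. -/
def enneperBeta {n : ℕ} (r : ℕ) (a : Fin n → ℝ) : ℝ := 1 + ∑ i ∈ affineIdx n r, a i ^ 2

/-- `- a_{n-r} ⋯ a_{n-1} / σ_{r-1}(a_{n-r}, …, a_{n-1})`. -/
def enneperSlope {n : ℕ} (r : ℕ) (a : Fin n → ℝ) : ℝ :=
  -((∏ k ∈ cosIdx n r, a k) / elemSymm (r - 1) (cosIdx n r) a)

/-- The function whose graph is a generalized periodic Enneper hypersurface. -/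
def enneperFun {n r : ℕ} (h : r < n) (a b : Fin n → ℝ) (c : ℝ) (x : Fin n → ℝ) : ℝ :=
  ∑ i ∈ affineIdx n r, a i * x i +
    ∑ k ∈ cosIdx n r, 1 / a k * Real.log
      |Real.cos (enneperSlope r a * √(enneperBeta r a) * x (lastIdx h) + b (lastIdx h)) /
        Real.cos (a k * √(enneperBeta r a) * x k + b k)| + c

/-- Graphs of `enneperFun` over products of open intervals on which the arguments of the cosines
lie in `(-π/2, π/2)`. -/
def IsEnneperGraph {n r : ℕ} (h : r < n) (M : Set (EuclideanSpace ℝ (Fin (n + 1)))) : Prop :=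
  ∃ (K : Fin n → Set ℝ) (a b : Fin n → ℝ) (c : ℝ),
    (∀ i, IsOpenInterval (K i)) ∧
    (∀ k ∈ cosIdx n r, a k ≠ 0) ∧
    elemSymm (r - 1) (cosIdx n r) a ≠ 0 ∧
    (∀ k ∈ cosIdx n r, ∀ t ∈ K k, |a k * √(enneperBeta r a) * t + b k| < Real.pi / 2) ∧
    (∀ t ∈ K (lastIdx h),
      |enneperSlope r a * √(enneperBeta r a) * t + b (lastIdx h)| < Real.pi / 2) ∧
    M = graphOver (enneperFun h a b c) (Set.univ.pi K)

end TranslationHypersurface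

end

/-!
For a translation graph with `p i = f i'` and `q i = f i''`, the shape operator is a positive
multiple of `(1 + p pᵀ)⁻¹ diag q`, so that by the rank-one determinant formula `S_r` is a positive
multiple of `∑_{#t = r} (∏_{i ∈ t} q i) (1 + ∑_{m ∉ t} (p m)²)`.
Since every summand depends on its own variable only, evaluating at several points separates the
variables. If fewer than `r` of the `f i` have a nonvanishing second derivative somewhere, all terms
vanish and the graph is a cylinder. Otherwise exactly `r + 1` of the `f i` are not affine, and for
those `q i = a i (β + (p i)²)` with constants such that `∑ (a i)⁻¹ = 0`; the solutions of this
equation are `-a⁻¹ log (cos (a √β t + b)) + d`, and eliminating one of the `a i` by the linear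
relation yields the Enneper form. Conversely, the vanishing of `S_r` is carried along by isometries
because the principal curvatures are determined up to a common sign by the graph as a set.
-/

noncomputable section

namespace TranslationHypersurface

open Finset Function

section ElementarySymmetric

variable {ι R : Type*}

/-- The `k`-th elementary symmetric polynomial of the `a i`, `i ∈ s`, in a commutative semiring;
`elemSymm` is the case of real numbers indexed by `Fin n`. -/
def esymmOn [CommSemiring R] (k : ℕ) (s : Finset ι) (a : ι → R) : R :=
  ∑ t ∈ s.powersetCard k, ∏ i ∈ t, a i

section CommSemiring

variable [CommSemiring R]

theorem esymmOn_zero (s : Finset ι) (a : ι → R) : esymmOn 0 s a = 1 := by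
  simp [esymmOn]

theorem esymmOn_congr {k : ℕ} {s : Finset ι} {a b : ι → R} (h : ∀ i ∈ s, a i = b i) :
    esymmOn k s a = esymmOn k s b :=
  sum_congr rfl fun _ ht => prod_congr rfl fun i hi => h i ((mem_powersetCard.1 ht).1 hi)

theorem esymmOn_of_card_lt {k : ℕ} {s : Finset ι} (h : #s < k) (a : ι → R) :
    esymmOn k s a = 0 := by
  simp [esymmOn, powersetCard_eq_empty.2 h]

theorem esymmOn_card (s : Finset ι) (a : ι → R) : esymmOn #s s a = ∏ i ∈ s, a i := by
  simp [esymmOn, powersetCard_self]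

theorem esymmOn_const_mul (k : ℕ) (s : Finset ι) (c : R) (a : ι → R) :
    esymmOn k s (fun i => c * a i) = c ^ k * esymmOn k s a := by
  rw [esymmOn, esymmOn, mul_sum]
  refine sum_congr rfl fun t ht => ?_
  rw [prod_mul_distrib, prod_const, (mem_powersetCard.1 ht).2]

theorem esymmOn_of_subset {k : ℕ} {s t : Finset ι} {a : ι → R} (hst : s ⊆ t)
    (h : ∀ i ∈ t, i ∉ s → a i = 0) : esymmOn k t a = esymmOn k s a := by
  refine (sum_subset (powersetCard_mono hst) fun u hu hus => ?_).symm
  rw [mem_powersetCard] at hu hus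
  obtain ⟨i, hiu, his⟩ := not_subset.1 fun hsub => hus ⟨hsub, hu.2⟩
  exact prod_eq_zero hiu (h i (hu.1 hiu) his)

variable [DecidableEq ι]

theorem esymmOn_insert {k : ℕ} {s : Finset ι} {i : ι} (hi : i ∉ s) (a : ι → R) :
    esymmOn (k + 1) (insert i s) a = esymmOn (k + 1) s a + a i * esymmOn k s a := by
  have hmem : ∀ t ∈ powersetCard k s, i ∉ t := fun t ht hit => hi ((mem_powersetCard.1 ht).1 hit)
  simp only [esymmOn]
  rw [powersetCard_succ_insert hi, sum_union, sum_image, mul_sum]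
  · exact congrArg _ (sum_congr rfl fun t ht => prod_insert (hmem t ht))
  · intro t ht u hu h
    rw [← erase_insert (hmem t ht), ← erase_insert (hmem u hu), h]
  · rw [disjoint_left]
    intro t ht ht'
    obtain ⟨u, -, rfl⟩ := mem_image.1 ht'
    exact hi ((mem_powersetCard.1 ht).1 (mem_insert_self _ _))

theorem esymmOn_erase {k : ℕ} {s : Finset ι} {i : ι} (hi : i ∈ s) (a : ι → R) :
    esymmOn (k + 1) s a = esymmOn (k + 1) (s.erase i) a + a i * esymmOn k (s.erase i) a := by
  rw [← esymmOn_insert (notMem_erase i s), insert_erase hi]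

theorem esymmOn_update_of_notMem {k : ℕ} {s : Finset ι} {i : ι} (hi : i ∉ s) (a : ι → R) (t : R) :
    esymmOn k s (update a i t) = esymmOn k s a :=
  esymmOn_congr fun _ hj => update_of_ne (ne_of_mem_of_not_mem hj hi) _ _

end CommSemiring

theorem sum_esymmOn_erase [DecidableEq ι] [CommRing R] (k : ℕ) (s : Finset ι) (a : ι → R) :
    ∑ i ∈ s, esymmOn k (s.erase i) a = ((#s : R) - k) * esymmOn k s a := by
  induction s using Finset.induction_on generalizing k with
  | empty =>
    cases k with
    | zero => simp
    | succ k => simp [esymmOn_of_card_lt (s := (∅ : Finset ι)) (Nat.succ_pos k)]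
  | insert j s hj ih =>
    rw [sum_insert hj, erase_insert hj, card_insert_of_notMem hj]
    cases k with
    | zero => simp [esymmOn_zero, add_comm]
    | succ k =>
      have hsum : ∑ i ∈ s, esymmOn (k + 1) ((insert j s).erase i) a =
          ∑ i ∈ s, (esymmOn (k + 1) (s.erase i) a + a j * esymmOn k (s.erase i) a) := by
        refine sum_congr rfl fun i hi => ?_
        rw [erase_insert_of_ne (ne_of_mem_of_not_mem hi hj).symm,
          esymmOn_insert fun h => hj (mem_of_mem_erase h)]
      rw [hsum, sum_add_distrib, ← mul_sum, ih, ih, esymmOn_insert hj]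
      push_cast
      ring

theorem sum_esymmOn_erase_of_card_eq [DecidableEq ι] [CommRing R] {k : ℕ} {s : Finset ι}
    (hs : #s = k + 1) (a : ι → R) : ∑ i ∈ s, esymmOn k (s.erase i) a = esymmOn k s a := by
  rw [sum_esymmOn_erase, hs, Nat.cast_add_one, add_sub_cancel_left, one_mul]

section Field

variable {K : Type*} [Field K]

theorem esymmOn_eq_prod_mul_sum_inv {k : ℕ} {s : Finset ι} (hs : #s = k + 1) {a : ι → K}
    (ha : ∀ i ∈ s, a i ≠ 0) : esymmOn k s a = (∏ i ∈ s, a i) * ∑ i ∈ s, (a i)⁻¹ := by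
  classical
  rw [← sum_esymmOn_erase_of_card_eq hs, mul_sum]
  refine sum_congr rfl fun i hi => ?_
  obtain rfl : #(s.erase i) = k := by rw [card_erase_of_mem hi, hs, Nat.add_sub_cancel]
  rw [esymmOn_card, ← mul_prod_erase s a hi, mul_comm (a i), mul_inv_cancel_right₀ (ha i hi)]

variable [DecidableEq ι] [CharZero K]

theorem exists_esymmOn_erase_ne_zero {k : ℕ} {s : Finset ι} {a : ι → K} (hk : k < #s)
    (ha : ∀ i ∈ s, a i ≠ 0) : ∃ i ∈ s, esymmOn k (s.erase i) a ≠ 0 := by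
  induction k with
  | zero =>
    obtain ⟨i, hi⟩ := card_pos.1 hk
    exact ⟨i, hi, by simp [esymmOn_zero]⟩
  | succ k ih =>
    by_contra! hzero
    have hs : esymmOn (k + 1) s a = 0 := by
      have hsum := sum_esymmOn_erase (k + 1) s a
      rw [sum_eq_zero hzero] at hsum
      exact (mul_eq_zero.1 hsum.symm).resolve_left (sub_ne_zero.2 (by exact_mod_cast hk.ne'))
    obtain ⟨i, hi, hne⟩ := ih (Nat.lt_of_succ_lt hk)
    have hrec := esymmOn_erase (k := k) hi a
    rw [hs, hzero i hi, zero_add] at hrec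
    exact mul_ne_zero (ha i hi) hne hrec.symm

theorem exists_esymmOn_erase_ne_zero_of_agreeOn {k : ℕ} {s C : Finset ι} {c : ι → K} (hk : k < #s)
    (hCs : C ⊆ s) (hC : C.Nonempty) (hc : ∀ i ∈ C, c i ≠ 0) :
    ∃ a : ι → K, (∀ i ∈ C, a i = c i) ∧ ∃ i ∈ C, esymmOn k (s.erase i) a ≠ 0 := by
  induction k generalizing s with
  | zero =>
    obtain ⟨i, hi⟩ := hC
    exact ⟨c, fun _ _ => rfl, i, hi, by simp [esymmOn_zero]⟩
  | succ k ih =>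
    by_cases hsC : s ⊆ C
    · obtain rfl := hsC.antisymm hCs
      exact ⟨c, fun _ _ => rfl, exists_esymmOn_erase_ne_zero hk hc⟩
    obtain ⟨j, hjs, hjC⟩ := not_subset.1 hsC
    obtain ⟨a, hac, i, hi, hne⟩ := ih (s := s.erase j)
      (by rw [card_erase_of_mem hjs]; exact Nat.lt_sub_of_add_lt hk)
      (subset_erase.2 ⟨hCs, hjC⟩)
    have hij : i ≠ j := ne_of_mem_of_not_mem hi hjC
    have hrec (t : K) : esymmOn (k + 1) (s.erase i) (update a j t) =
        esymmOn (k + 1) ((s.erase j).erase i) a + t * esymmOn k ((s.erase j).erase i) a := by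
      rw [esymmOn_erase (mem_erase.2 ⟨hij.symm, hjs⟩), update_self, erase_right_comm,
        esymmOn_update_of_notMem (by simp), esymmOn_update_of_notMem (by simp)]
    have hagree (t : K) : ∀ l ∈ C, update a j t l = c l := fun l hl => by
      rw [update_of_ne (ne_of_mem_of_not_mem hl hjC), hac l hl]
    by_cases hzero : esymmOn (k + 1) (s.erase i) (update a j 0) = 0
    · refine ⟨update a j 1, hagree 1, i, hi, ?_⟩
      rw [hrec, zero_mul, add_zero] at hzero
      rwa [hrec, hzero, one_mul, zero_add]
    · exact ⟨update a j 0, hagree 0, i, hi, hzero⟩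

end Field

end ElementarySymmetric

section MixedSum

variable {ι R : Type*} [DecidableEq ι]

/-- `β e_k(h) + ∑ m, w m * e_k(h without h m)`, the sums running over the index set `A`. For
`β = 1`, with `h` the second derivatives and `w` the squared slopes, this is `S_k` of a translation
hypersurface up to a positive factor. -/
def mixedSum [CommSemiring R] (k : ℕ) (A : Finset ι) (β : R) (h w : ι → R) : R :=
  β * esymmOn k A h + ∑ m ∈ A, w m * esymmOn k (A.erase m) h

section CommSemiring

variable [CommSemiring R]

theorem mixedSum_congr {k : ℕ} {A : Finset ι} {β : R} {h w h' w' : ι → R}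
    (hh : ∀ i ∈ A, h i = h' i) (hw : ∀ i ∈ A, w i = w' i) :
    mixedSum k A β h w = mixedSum k A β h' w' := by
  rw [mixedSum, mixedSum, esymmOn_congr hh]
  refine congrArg _ (sum_congr rfl fun i hi => ?_)
  rw [hw i hi, esymmOn_congr fun l hl => hh l (mem_of_mem_erase hl)]

theorem mixedSum_of_subset {k : ℕ} {A B : Finset ι} {β : R} {h w : ι → R} (hAB : A ⊆ B)
    (hh : ∀ i ∈ B, i ∉ A → h i = 0) :
    mixedSum k B β h w = mixedSum k A (β + ∑ m ∈ B \ A, w m) h w := by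
  rw [mixedSum, mixedSum, esymmOn_of_subset hAB hh, ← sum_sdiff hAB, add_mul, sum_mul, add_assoc]
  congr 2
  · refine sum_congr rfl fun m hm => ?_
    rw [mem_sdiff] at hm
    rw [esymmOn_of_subset (subset_erase.2 ⟨hAB, hm.2⟩)]
    exact fun i hi hiA => hh i (mem_of_mem_erase hi) hiA
  · refine sum_congr rfl fun m _ => ?_
    rw [esymmOn_of_subset (erase_subset_erase m hAB)]
    intro i hi hiA
    rw [mem_erase] at hi
    exact hh i hi.2 fun hA => hiA (mem_erase.2 ⟨hi.1, hA⟩)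

theorem mixedSum_of_card_lt {k : ℕ} {A : Finset ι} (hA : #A < k) (β : R) (h w : ι → R) :
    mixedSum k A β h w = 0 := by
  rw [mixedSum, esymmOn_of_card_lt hA, mul_zero, zero_add]
  refine sum_eq_zero fun m _ => ?_
  rw [esymmOn_of_card_lt ((card_le_card (erase_subset m A)).trans_lt hA), mul_zero]

theorem mixedSum_card (A : Finset ι) (β : R) (h w : ι → R) :
    mixedSum #A A β h w = β * ∏ i ∈ A, h i := by
  rw [mixedSum, esymmOn_card, sum_eq_zero, add_zero]
  intro m hm
  rw [esymmOn_of_card_lt (card_erase_lt_of_mem hm), mul_zero]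

theorem mixedSum_update_right {k : ℕ} {A : Finset ι} {i : ι} (hi : i ∈ A) (β : R) (h w : ι → R)
    (t : R) :
    mixedSum k A β h (update w i t) =
      mixedSum k A β h (update w i 0) + t * esymmOn k (A.erase i) h := by
  simp only [mixedSum]
  rw [← add_sum_erase A _ hi, ← add_sum_erase A _ hi, update_self, update_self, zero_mul, zero_add,
    add_comm (t * _), add_assoc]
  congr 2
  refine sum_congr rfl fun m hm => ?_
  rw [update_of_ne (ne_of_mem_erase hm), update_of_ne (ne_of_mem_erase hm)]

theorem exists_esymmOn_update_eq (k : ℕ) (A : Finset ι) (i : ι) (h : ι → R) :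
    ∃ a b : R, ∀ t, esymmOn k A (update h i t) = a + b * t := by
  by_cases hi : i ∈ A
  · cases k with
    | zero => exact ⟨1, 0, fun t => by simp [esymmOn_zero]⟩
    | succ k =>
      refine ⟨esymmOn (k + 1) (A.erase i) h, esymmOn k (A.erase i) h, fun t => ?_⟩
      rw [esymmOn_erase hi, update_self, esymmOn_update_of_notMem (notMem_erase i A),
        esymmOn_update_of_notMem (notMem_erase i A), mul_comm]
  · exact ⟨esymmOn k A h, 0, fun t => by rw [esymmOn_update_of_notMem hi, zero_mul, add_zero]⟩

theorem exists_mixedSum_update_eq (k : ℕ) {A : Finset ι} {i : ι} (hi : i ∈ A) (β : R)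
    (h w : ι → R) :
    ∃ a b c : R, ∀ u v, mixedSum k A β (update h i u) (update w i v) = a + b * u + c * v := by
  obtain ⟨a, b, hab⟩ := exists_esymmOn_update_eq k A i h
  choose a' b' hab' using fun m => exists_esymmOn_update_eq k (A.erase m) i h
  refine ⟨β * a + ∑ m ∈ A.erase i, w m * a' m, β * b + ∑ m ∈ A.erase i, w m * b' m,
    esymmOn k (A.erase i) h, fun u v => ?_⟩
  have hsum : ∑ m ∈ A.erase i, update w i v m * esymmOn k (A.erase m) (update h i u) =
      ∑ m ∈ A.erase i, w m * a' m + (∑ m ∈ A.erase i, w m * b' m) * u := by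
    rw [sum_mul, ← sum_add_distrib]
    refine sum_congr rfl fun m hm => ?_
    rw [update_of_ne (ne_of_mem_erase hm), hab']
    ring
  rw [mixedSum, hab, ← add_sum_erase A _ hi, hsum, update_self,
    esymmOn_update_of_notMem (notMem_erase i A)]
  ring

end CommSemiring

theorem mixedSum_of_card_eq_succ [CommRing R] {k : ℕ} {A : Finset ι} (hA : #A = k + 1) (β : R)
    (h w : ι → R) : mixedSum k A β h w = ∑ m ∈ A, (β + w m) * ∏ i ∈ A.erase m, h i := by
  rw [mixedSum, ← sum_esymmOn_erase_of_card_eq hA, mul_sum, ← sum_add_distrib]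
  refine sum_congr rfl fun i hi => ?_
  obtain rfl : #(A.erase i) = k := by rw [card_erase_of_mem hi, hA, Nat.add_sub_cancel]
  rw [esymmOn_card, ← add_mul]

end MixedSum

section Separation

variable {ι K : Type*} [Field K]

theorem eq_zero_of_sum_eq_zero_of_card_eq [CharZero K] {A : Finset ι} {m : ℕ} (hm : m ≠ 0)
    (hmA : m < #A) {ε : ι → K} (hε : ∀ I ⊆ A, #I = m → ∑ i ∈ I, ε i = 0) :
    ∀ i ∈ A, ε i = 0 := by
  classical
  intro i hi
  obtain ⟨T, hTA, hT⟩ := exists_subset_card_eq (s := A.erase i) (n := m)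
    (by rw [card_erase_of_mem hi]; exact Nat.le_sub_one_of_lt hmA)
  have hT0 := hε T (hTA.trans (erase_subset i A)) hT
  have hiT : i ∉ T := fun h => notMem_erase i A (hTA h)
  have hswap : ∀ j ∈ T, ε j = ε i := fun j hj => by
    have hiTj : i ∉ T.erase j := fun h => hiT (mem_of_mem_erase h)
    have hsum := hε (insert i (T.erase j))
      (insert_subset hi ((erase_subset j T).trans (hTA.trans (erase_subset i A))))
      (by rw [card_insert_of_notMem hiTj, card_erase_add_one hj, hT])
    rw [sum_insert hiTj] at hsum
    rw [← add_sum_erase T ε hj] at hT0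
    linear_combination hT0 - hsum
  rw [sum_congr rfl hswap, sum_const, hT, nsmul_eq_mul] at hT0
  exact (mul_eq_zero.1 hT0).resolve_left (Nat.cast_ne_zero.2 hm)

theorem exists_eq_const_of_sum_eq_zero {T : ι → Type*} [∀ i, Nonempty (T i)] {A : Finset ι}
    {φ : ∀ i, T i → K} (hφ : ∀ x : ∀ i, T i, ∑ i ∈ A, φ i (x i) = 0) :
    ∃ c : ι → K, ∑ i ∈ A, c i = 0 ∧ ∀ i ∈ A, ∀ t, φ i t = c i := by
  classical
  let p : ∀ i, T i := fun i => Classical.arbitrary (T i)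
  refine ⟨fun i => φ i (p i), hφ p, fun i hi t => ?_⟩
  have ht := hφ (update p i t)
  rw [← add_sum_erase A _ hi, update_self, sum_congr rfl fun j hj => by
    rw [update_of_ne (ne_of_mem_erase hj)]] at ht
  have hp := hφ p
  rw [← add_sum_erase A _ hi] at hp
  linear_combination ht - hp

variable [DecidableEq ι]

theorem eq_zero_of_affine_of_eq_zero_at_pairs {A : Finset ι} {G : (ι → K) → K} {p q : ι → K}
    (hG : ∀ i ∈ A, ∀ x, ∃ a b : K, ∀ t, G (update x i t) = a + b * t) (hpq : ∀ i ∈ A, p i ≠ q i)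
    (hzero : ∀ x, (∀ i ∈ A, x i = p i ∨ x i = q i) → G x = 0) (x : ι → K) : G x = 0 := by
  induction A using Finset.induction_on with
  | empty => exact hzero x (by simp)
  | insert j A hj ih =>
    rw [forall_mem_insert] at hG hpq
    refine ih hG.2 hpq.2 fun y hy => ?_
    have hend (t : K) (ht : t = p j ∨ t = q j) : G (update y j t) = 0 := by
      refine hzero _ (forall_mem_insert _ _ _ |>.2 ⟨by rwa [update_self], fun i hi => ?_⟩)
      rw [update_of_ne (ne_of_mem_of_not_mem hi hj)]
      exact hy i hi
    obtain ⟨a, b, hab⟩ := hG.1 y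
    have hp := hab (p j) ▸ hend _ (.inl rfl)
    have hq := hab (q j) ▸ hend _ (.inr rfl)
    have hb : b = 0 :=
      (mul_eq_zero.1 (by linear_combination hp - hq : b * (p j - q j) = 0)).resolve_right
        (sub_ne_zero.2 hpq.1)
    rw [← update_eq_self j y, hab, hb]
    linear_combination hp - p j * hb

theorem forall_eq_zero_of_mixedSum_affine_eq_zero [CharZero K] {r : ℕ} {A : Finset ι} {β : K}
    {c ε : ι → K} (hA : r + 1 < #A)
    (hzero : ∀ h : ι → K, mixedSum r A β h (fun i => c i + ε i * h i) = 0) :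
    ∀ i ∈ A, ε i = 0 := by
  refine eq_zero_of_sum_eq_zero_of_card_eq r.succ_ne_zero hA fun I hI hcard => ?_
  let e : ι → K := fun i => if i ∈ I then 1 else 0
  have htop : ∑ m ∈ A, ε m * e m * esymmOn r (A.erase m) e = ∑ i ∈ I, ε i := by
    rw [← sum_subset hI fun m _ hm => by simp [e, hm]]
    refine sum_congr rfl fun m hm => ?_
    have hcard' : #(I.erase m) = r := by rw [card_erase_of_mem hm, hcard]; rfl
    rw [esymmOn_of_subset (erase_subset_erase m hI) fun i hi hiI => if_neg fun h =>
        hiI (mem_erase.2 ⟨ne_of_mem_erase hi, h⟩), ← hcard', esymmOn_card,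
      prod_eq_one fun i hi => if_pos (mem_of_mem_erase hi), mul_one]
    simp only [e, if_pos hm, mul_one]
  have hexpand (t : K) : t ^ r * (mixedSum r A β e c + t * ∑ i ∈ I, ε i) = 0 := by
    rw [← hzero fun i => t * e i, mixedSum, mixedSum, ← htop]
    simp only [esymmOn_const_mul, mul_add, add_mul, sum_add_distrib, mul_sum]
    rw [add_assoc]
    refine congrArg₂ _ (by ring) (congrArg₂ _ ?_ ?_) <;> exact sum_congr rfl fun _ _ => by ring
  have hpos := (mul_eq_zero.1 (hexpand 1)).resolve_left (pow_ne_zero r one_ne_zero)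
  have hneg := (mul_eq_zero.1 (hexpand (-1))).resolve_left (pow_ne_zero r (by simp))
  exact (mul_eq_zero.1 (by linear_combination hpos - hneg : 2 * ∑ i ∈ I, ε i = 0)).resolve_left
    two_ne_zero

theorem card_le_of_mixedSum_line_eq_zero [CharZero K] {r : ℕ} {A : Finset ι} {β : K} {γ δ : ι → K}
    (hγδ : ∀ i ∈ A, γ i ≠ 0 ∨ δ i ≠ 0)
    (hzero : ∀ w : ι → K, mixedSum r A β (fun i => γ i + δ i * w i) w = 0) : #A ≤ r + 1 := by
  classical
  by_contra! hA
  by_cases hδ : ∃ i ∈ A, δ i = 0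
  · -- An entry `w i` that does not move `h` occurs only as the coefficient of `e_r(A \ i; h)`.
    obtain ⟨i₀, hi₀, hδ₀⟩ := hδ
    obtain ⟨a, ha, i, hi, hne⟩ := exists_esymmOn_erase_ne_zero_of_agreeOn (k := r) (s := A)
      (C := {i ∈ A | δ i = 0}) (c := γ) (by omega) (filter_subset _ _)
      ⟨i₀, mem_filter.2 ⟨hi₀, hδ₀⟩⟩ fun i hi =>
        (hγδ i (mem_filter.1 hi).1).resolve_right (not_not.2 (mem_filter.1 hi).2)
    obtain ⟨hiA, hδi⟩ := mem_filter.1 hi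
    let w : ι → K := fun l => (a l - γ l) / δ l
    have hline (t : K) : mixedSum r A β a (update w i t) = 0 := by
      rw [← hzero (update w i t)]
      refine mixedSum_congr (fun l hl => ?_) fun _ _ => rfl
      by_cases hδl : δ l = 0
      · rw [hδl, zero_mul, add_zero, ha l (mem_filter.2 ⟨hl, hδl⟩)]
      · rw [update_of_ne (by rintro rfl; exact hδl hδi), mul_div_cancel₀ _ hδl, add_sub_cancel]
    have hone := mixedSum_update_right (k := r) hiA β a w 1
    rw [hline, hline, zero_add, one_mul] at hone
    exact hne hone.symm
  · -- Otherwise `h` is a coordinate system and `w` an affine function of it.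
    push Not at hδ
    obtain ⟨i, hi⟩ := card_pos.1 (by omega : 0 < #A)
    refine inv_ne_zero (hδ i hi) (forall_eq_zero_of_mixedSum_affine_eq_zero (β := β)
      (c := fun i => -(γ i / δ i)) (ε := fun i => (δ i)⁻¹) hA (fun h => ?_) i hi)
    rw [← hzero fun i => -(γ i / δ i) + (δ i)⁻¹ * h i]
    refine mixedSum_congr (fun l hl => ?_) fun _ _ => rfl
    field_simp [hδ l hl]
    ring

section Families

variable {T : ι → Type*} [∀ i, Nonempty (T i)]

theorem card_le_of_mixedSum_eq_zero [CharZero K] {r : ℕ} {A : Finset ι} {β : K}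
    {h w : ∀ i, T i → K} (hA : ∀ i ∈ A, ∃ s t, h i s ≠ 0 ∧ w i s ≠ w i t)
    (hzero : ∀ x : ∀ i, T i, mixedSum r A β (fun i => h i (x i)) (fun i => w i (x i)) = 0) :
    #A ≤ r + 1 := by
  choose! s t hs hst using hA
  let δ : ι → K := fun i => (h i (t i) - h i (s i)) / (w i (t i) - w i (s i))
  let γ : ι → K := fun i => h i (s i) - δ i * w i (s i)
  have hγδ_left (i : ι) : γ i + δ i * w i (s i) = h i (s i) := sub_add_cancel _ _
  have hγδ_right : ∀ i ∈ A, γ i + δ i * w i (t i) = h i (t i) := fun i hi => by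
    have hδ : δ i * (w i (t i) - w i (s i)) = h i (t i) - h i (s i) :=
      div_mul_cancel₀ _ (sub_ne_zero.2 (hst i hi).symm)
    linear_combination hγδ_left i + hδ
  refine card_le_of_mixedSum_line_eq_zero (β := β) (γ := γ) (δ := δ) (fun i hi => ?_) ?_
  · by_contra! h0
    exact hs i hi (by rw [← hγδ_left, h0.1, h0.2, zero_mul, add_zero])
  · refine eq_zero_of_affine_of_eq_zero_at_pairs (fun i hi y => ?_) hst fun y hy => ?_
    · obtain ⟨a, b, c, habc⟩ := exists_mixedSum_update_eq r hi β (fun j => γ j + δ j * y j) y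
      refine ⟨a + b * γ i, b * δ i + c, fun v => ?_⟩
      have hupd : (fun j => γ j + δ j * update y i v j) =
          update (fun j => γ j + δ j * y j) i (γ i + δ i * v) := by
        ext j
        by_cases hj : j = i
        · subst hj; simp only [update_self]
        · simp only [update_of_ne hj]
      rw [hupd, habc]
      ring
    · classical
      let x : ∀ i, T i := fun i => if y i = w i (s i) then s i else t i
      rw [← hzero x]
      refine mixedSum_congr (fun i hi => ?_) fun i hi => ?_ <;> by_cases hys : y i = w i (s i)
      · simp only [x, if_pos hys, hys, hγδ_left]
      · simp only [x, if_neg hys, (hy i hi).resolve_left hys, hγδ_right i hi]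
      · simp only [x, if_pos hys, hys]
      · simp only [x, if_neg hys, (hy i hi).resolve_left hys]

theorem ne_zero_of_mixedSum_eq_zero {r : ℕ} {A : Finset ι} (hA : #A = r + 1) {β : K}
    {h w : ∀ i, T i → K} (hw : ∀ i ∈ A, ∀ t, β + w i t ≠ 0) (hh : ∀ i ∈ A, ∃ t, h i t ≠ 0)
    (hzero : ∀ x : ∀ i, T i, mixedSum r A β (fun i => h i (x i)) (fun i => w i (x i)) = 0) :
    ∀ i ∈ A, ∀ t, h i t ≠ 0 := by
  intro i hi t hit
  choose! p hp using hh
  have hx := hzero (update p i t)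
  rw [mixedSum_of_card_eq_succ hA, sum_eq_single_of_mem i hi, update_self] at hx
  · refine mul_ne_zero (hw i hi t) (prod_ne_zero_iff.2 fun j hj => ?_) hx
    rw [update_of_ne (ne_of_mem_erase hj)]
    exact hp j (mem_of_mem_erase hj)
  · intro m _ hmi
    rw [prod_eq_zero (mem_erase.2 ⟨hmi.symm, hi⟩) (by rwa [update_self]), mul_zero]

theorem exists_proportional_of_mixedSum_eq_zero {r : ℕ} {A : Finset ι} (hA : #A = r + 1) {β : K}
    {h w : ∀ i, T i → K} (hw : ∀ i ∈ A, ∀ t, β + w i t ≠ 0) (hh : ∀ i ∈ A, ∃ t, h i t ≠ 0)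
    (hzero : ∀ x : ∀ i, T i, mixedSum r A β (fun i => h i (x i)) (fun i => w i (x i)) = 0) :
    ∃ a : ι → K, ∑ i ∈ A, (a i)⁻¹ = 0 ∧ ∀ i ∈ A, a i ≠ 0 ∧ ∀ t, h i t = a i * (β + w i t) := by
  have hne := ne_zero_of_mixedSum_eq_zero hA hw hh hzero
  obtain ⟨c, hc, hφc⟩ := exists_eq_const_of_sum_eq_zero (A := A)
    (φ := fun i t => (β + w i t) / h i t) fun x => by
      have hprod : ∏ i ∈ A, h i (x i) ≠ 0 := prod_ne_zero_iff.2 fun i hi => hne i hi _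
      refine (mul_eq_zero.1 ?_).resolve_left hprod
      rw [← hzero x, mixedSum_of_card_eq_succ hA, mul_sum]
      refine sum_congr rfl fun i hi => ?_
      rw [← mul_prod_erase A _ hi]
      field_simp [hne i hi (x i)]
  have hc0 : ∀ i ∈ A, c i ≠ 0 := fun i hi => by
    rw [← hφc i hi (Classical.arbitrary _)]
    exact div_ne_zero (hw i hi _) (hne i hi _)
  refine ⟨fun i => (c i)⁻¹, by simpa only [inv_inv] using hc, fun i hi =>
    ⟨inv_ne_zero (hc0 i hi), fun t => ?_⟩⟩
  dsimp only
  rw [← hφc i hi t, inv_div, div_mul_cancel₀ _ (hw i hi t)]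

theorem mixedSum_eq_zero_of_proportional {r : ℕ} {A : Finset ι} (hA : #A = r + 1) {β : K}
    {a h w : ι → K} (ha : ∀ i ∈ A, a i ≠ 0) (hsum : ∑ i ∈ A, (a i)⁻¹ = 0)
    (hh : ∀ i ∈ A, h i = a i * (β + w i)) : mixedSum r A β h w = 0 := by
  rw [mixedSum_of_card_eq_succ hA, ← mul_zero (∏ i ∈ A, h i), ← hsum, mul_sum]
  refine sum_congr rfl fun i hi => ?_
  rw [← mul_prod_erase A h hi, hh i hi]
  field_simp [ha i hi]

theorem forall_mixedSum_eq_zero_iff [CharZero K] {r : ℕ} {A : Finset ι} {β : K} (hβ : β ≠ 0)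
    {h w : ∀ i, T i → K} (hA : ∀ i ∈ A, ∃ s t, h i s ≠ 0 ∧ w i s ≠ w i t)
    (hw : ∀ i ∈ A, ∀ t, β + w i t ≠ 0) :
    (∀ x : ∀ i, T i, mixedSum r A β (fun i => h i (x i)) (fun i => w i (x i)) = 0) ↔
      #A < r ∨ #A = r + 1 ∧ ∃ a : ι → K, ∑ i ∈ A, (a i)⁻¹ = 0 ∧
        ∀ i ∈ A, a i ≠ 0 ∧ ∀ t, h i t = a i * (β + w i t) := by
  have hh : ∀ i ∈ A, ∃ t, h i t ≠ 0 := fun i hi => (hA i hi).imp fun _ ⟨_, hs, _⟩ => hs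
  refine ⟨fun hzero => ?_, ?_⟩
  · have hne : #A ≠ r := by
      rintro rfl
      choose! p hp using hh
      have hx := hzero p
      rw [mixedSum_card] at hx
      exact mul_ne_zero hβ (prod_ne_zero_iff.2 hp) hx
    rcases lt_or_ge #A r with hlt | hge
    · exact .inl hlt
    · have hcard : #A = r + 1 := by have := card_le_of_mixedSum_eq_zero hA hzero; omega
      exact .inr ⟨hcard, exists_proportional_of_mixedSum_eq_zero hcard hw hh hzero⟩
  · rintro (hlt | ⟨hcard, a, hsum, ha⟩) x
    · exact mixedSum_of_card_lt hlt _ _ _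
    · exact mixedSum_eq_zero_of_proportional hcard (fun i hi => (ha i hi).1) hsum
        fun i hi => (ha i hi).2 (x i)

end Families

end Separation

section Determinant

open Polynomial Matrix

variable {m R : Type*} [Fintype m] [DecidableEq m] [CommRing R]

theorem det_diagonal_add_vecMulVec_of_isUnit {d : m → R} (hd : ∀ i, IsUnit (d i)) (u v : m → R) :
    (diagonal d + vecMulVec u v).det =
      ∏ i, d i + ∑ j, u j * v j * ∏ i ∈ univ.erase j, d i := by
  choose e he using fun i => (hd i).exists_right_inv
  have hfactor : diagonal d + vecMulVec u v =
      diagonal d * (1 + replicateCol Unit (fun i => e i * u i) * replicateRow Unit v) := by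
    rw [mul_add, mul_one, ← Matrix.mul_assoc]
    congr 1
    ext i j
    simp [vecMulVec_apply, mul_apply, diagonal_apply, ← mul_assoc, he]
  rw [hfactor, det_mul, det_diagonal, det_one_add_replicateCol_mul_replicateRow, mul_add, mul_one,
    dotProduct, mul_sum]
  refine congrArg _ (sum_congr rfl fun j _ => ?_)
  rw [← mul_prod_erase univ d (mem_univ j)]
  linear_combination (u j * v j * ∏ i ∈ univ.erase j, d i) * he j

theorem map_det_diagonal_add_vecMulVec {S : Type*} [CommRing S] (φ : R →+* S) (d u v : m → R) :
    φ (diagonal d + vecMulVec u v).det =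
      (diagonal (fun i => φ (d i)) + vecMulVec (fun i => φ (u i)) fun i => φ (v i)).det := by
  rw [RingHom.map_det]
  congr 1
  ext i j
  simp [vecMulVec_apply, diagonal_apply, apply_ite φ]

theorem det_diagonal_add_vecMulVec (d u v : m → R) :
    (diagonal d + vecMulVec u v).det =
      ∏ i, d i + ∑ j, u j * v j * ∏ i ∈ univ.erase j, d i := by
  -- A polynomial identity: it suffices to treat indeterminates, units of the fraction field.
  let S := MvPolynomial (Fin 3 × m) ℤ
  let x (k : Fin 3) (i : m) : S := MvPolynomial.X (k, i)
  have huniv : (diagonal (x 0) + vecMulVec (x 1) (x 2)).det =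
      ∏ i, x 0 i + ∑ j, x 1 j * x 2 j * ∏ i ∈ univ.erase j, x 0 i := by
    apply IsFractionRing.injective S (FractionRing S)
    rw [map_det_diagonal_add_vecMulVec, det_diagonal_add_vecMulVec_of_isUnit fun i =>
      (IsFractionRing.to_map_ne_zero_of_mem_nonZeroDivisors
        (mem_nonZeroDivisors_of_ne_zero (MvPolynomial.X_ne_zero _))).isUnit]
    simp only [map_add, map_sum, map_prod, map_mul]
  have h := congrArg (MvPolynomial.eval₂Hom (Int.castRingHom R) fun p => ![d, u, v] p.1 p.2) huniv
  simpa [map_det_diagonal_add_vecMulVec, x, -MvPolynomial.coe_eval₂Hom] using h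

theorem charpoly_inv_mul {G H : Matrix m m R} (hG : IsUnit G.det) :
    C G.det * (G⁻¹ * H).charpoly = ((X : R[X]) • G.map C - H.map C).det := by
  have hH : H.map (C : R →+* R[X]) = G.map C * (G⁻¹ * H).map C := by
    rw [← Matrix.map_mul, mul_nonsing_inv_cancel_left G H hG]
  have hfactor : (X : R[X]) • G.map C - H.map C = G.map C * (G⁻¹ * H).charmatrix := by
    rw [charmatrix, mul_sub, RingHom.mapMatrix_apply, ← hH, scalar_apply,
      ← smul_one_eq_diagonal, Matrix.mul_smul, mul_one]
  rw [hfactor, det_mul, charpoly, RingHom.map_det, RingHom.mapMatrix_apply]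

theorem coeff_charpoly_smul {r : ℕ} (hr : r ≤ Fintype.card m) (c : R)
    (M : Matrix m m R) :
    (c • M).charpoly.coeff (Fintype.card m - r) =
      c ^ r * M.charpoly.coeff (Fintype.card m - r) := by
  nontriviality R
  have hrev (N : Matrix m m R) : N.charpoly.coeff (Fintype.card m - r) = N.charpolyRev.coeff r := by
    rw [← reverse_charpoly, coeff_reverse, charpoly_natDegree_eq_dim, revAt_le hr]
  have hcomp : (c • M).charpolyRev = M.charpolyRev.comp (C c * X) := by
    have hmat : 1 - (X : R[X]) • (c • M).map C =
        (compRingHom (C c * X)).mapMatrix (1 - (X : R[X]) • M.map C) := by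
      ext1 i j
      by_cases hij : i = j <;> simp [hij, one_apply] <;> ring
    rw [charpolyRev, hmat, ← RingHom.map_det]
    rfl
  rw [hrev, hrev, hcomp, comp_C_mul_X_coeff, mul_comm]

theorem coeff_prod_X_sub_C {ι : Type*} {k : ℕ} {s : Finset ι} (a : ι → R) (hk : k ≤ #s) :
    (∏ i ∈ s, (X - C (a i))).coeff (#s - k) = (-1) ^ k * esymmOn k s a := by
  have h := prod_X_add_C_coeff s (fun i => -a i) (k := #s - k) (Nat.sub_le _ _)
  simp only [map_neg, ← sub_eq_add_neg] at h
  rw [h, Nat.sub_sub_self hk, ← esymmOn_const_mul]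
  simp only [esymmOn, neg_one_mul]

theorem coeff_charpoly_inv_one_add_vecMulVec_mul_diagonal {r : ℕ} (hr : r < Fintype.card m)
    {u v : m → R} (huv : IsUnit (1 + ∑ i, u i * v i)) (κ : m → R) :
    (1 + ∑ i, u i * v i) *
        ((1 + vecMulVec u v)⁻¹ * diagonal κ).charpoly.coeff (Fintype.card m - r) =
      (-1) ^ r * mixedSum r univ 1 κ fun i => u i * v i := by
  have hdet : (1 + vecMulVec u v).det = 1 + ∑ i, u i * v i := by
    simp [← diagonal_one, det_diagonal_add_vecMulVec]
  have hpencil : (X : R[X]) • (1 + vecMulVec u v).map C - (diagonal κ).map C =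
      diagonal (fun i => X - C (κ i)) + vecMulVec (fun i => X * C (u i)) fun i => C (v i) := by
    ext1 i j
    by_cases hij : i = j <;> simp [vecMulVec_apply, hij] <;> ring
  have hterm (j : m) :
      (X * C (u j) * C (v j) * ∏ i ∈ univ.erase j, (X - C (κ i))).coeff (Fintype.card m - r) =
        (-1) ^ r * (u j * v j * esymmOn r (univ.erase j) κ) := by
    have hcard : #(univ.erase j) = Fintype.card m - 1 := by simp
    have hcoeff := coeff_prod_X_sub_C (k := r) (s := univ.erase j) κ (by omega)
    rw [hcard] at hcoeff
    rw [mul_assoc X, mul_assoc X, ← C_mul,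
      show Fintype.card m - r = Fintype.card m - 1 - r + 1 by omega, coeff_X_mul, coeff_C_mul,
      hcoeff]
    ring
  have h := congrArg (coeff · (Fintype.card m - r)) (charpoly_inv_mul (H := diagonal κ)
    (hdet ▸ huv : IsUnit (1 + vecMulVec u v).det))
  simp only [hpencil, hdet, det_diagonal_add_vecMulVec, coeff_C_mul, coeff_add, finsetSum_coeff,
    hterm] at h
  rw [h, ← card_univ, coeff_prod_X_sub_C κ (hr.le.trans_eq card_univ.symm), mixedSum, one_mul,
    ← mul_sum, mul_add]

end Determinant

section Graph

variable {n : ℕ}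

/-- The splitting `ℝⁿ × ℝ ≃ ℝⁿ⁺¹` into horizontal and vertical parts, as an isomorphism of
topological vector spaces: the left side carries the supremum norm, so it is not an isometry. -/
def snocEquiv (n : ℕ) : ((Fin n → ℝ) × ℝ) ≃L[ℝ] EuclideanSpace ℝ (Fin (n + 1)) :=
  LinearEquiv.toContinuousLinearEquiv
    { toFun := fun p => WithLp.toLp 2 (Fin.snoc (α := fun _ => ℝ) p.1 p.2)
      invFun := fun z => (fun i => z i.castSucc, z (Fin.last n))
      map_add' := fun p q => by
        ext i
        refine Fin.lastCases ?_ (fun i => ?_) i <;> simp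
      map_smul' := fun c p => by
        ext i
        refine Fin.lastCases ?_ (fun i => ?_) i <;> simp
      left_inv := fun p => by ext <;> simp
      right_inv := fun z => by
        ext i
        refine Fin.lastCases ?_ (fun i => ?_) i <;> simp }

theorem inner_snocEquiv (v w : Fin n → ℝ) (a b : ℝ) :
    inner ℝ (snocEquiv n (v, a)) (snocEquiv n (w, b)) = ∑ i, v i * w i + a * b := by
  simp [snocEquiv, PiLp.inner_apply, Fin.sum_univ_castSucc, mul_comm]

theorem graphParam_eq (F : (Fin n → ℝ) → ℝ) (x : Fin n → ℝ) :
    graphParam F x = snocEquiv n (x, F x) := rfl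

theorem graphNormal_eq (F : (Fin n → ℝ) → ℝ) (x : Fin n → ℝ) :
    graphNormal F x = (√(1 + ∑ i, partialDeriv i F x ^ 2))⁻¹ •
      snocEquiv n (fun i => -partialDeriv i F x, 1) := rfl

theorem fderiv_graphParam {F : (Fin n → ℝ) → ℝ} {x : Fin n → ℝ} (hF : DifferentiableAt ℝ F x)
    (v : Fin n → ℝ) : fderiv ℝ (graphParam F) x v = snocEquiv n (v, fderiv ℝ F x v) := by
  have h : HasFDerivAt (graphParam F) _ x :=
    (snocEquiv n).hasFDerivAt.comp x ((hasFDerivAt_id x).prodMk hF.hasFDerivAt)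
  rw [h.fderiv]
  rfl

theorem firstForm_graphParam {F : (Fin n → ℝ) → ℝ} {x : Fin n → ℝ} (hF : DifferentiableAt ℝ F x) :
    firstForm (graphParam F) x =
      1 + Matrix.vecMulVec (fun i => partialDeriv i F x) fun i => partialDeriv i F x := by
  ext i j
  simp [firstForm, partialDeriv, fderiv_graphParam hF, inner_snocEquiv, Matrix.vecMulVec_apply,
    Matrix.one_apply, Pi.single_apply, eq_comm]

theorem differentiableAt_partialDeriv {E : Type*} [NormedAddCommGroup E] [NormedSpace ℝ E]
    {X : (Fin n → ℝ) → E} {x : Fin n → ℝ} (hX : ContDiffAt ℝ 2 X x) (i : Fin n) :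
    DifferentiableAt ℝ (partialDeriv i X) x :=
  ((hX.fderiv_right (m := 1) le_rfl).differentiableAt one_ne_zero).clm_apply
    (differentiableAt_const _)

theorem partialDeriv_partialDeriv_graphParam {F : (Fin n → ℝ) → ℝ} {x : Fin n → ℝ}
    (hF : ContDiffAt ℝ 2 F x) (i j : Fin n) :
    partialDeriv i (partialDeriv j (graphParam F)) x =
      snocEquiv n (0, partialDeriv i (partialDeriv j F) x) := by
  have heq : partialDeriv j (graphParam F) =ᶠ[nhds x]
      fun y => snocEquiv n (Pi.single j 1, partialDeriv j F y) := by
    filter_upwards [hF.eventually (by simp)] with y hy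
    exact fderiv_graphParam (hy.differentiableAt two_ne_zero) _
  have h : HasFDerivAt (fun y => snocEquiv n (Pi.single j 1, partialDeriv j F y)) _ x :=
    (snocEquiv n).hasFDerivAt.comp x ((hasFDerivAt_const _ x).prodMk
      (differentiableAt_partialDeriv hF j).hasFDerivAt)
  rw [partialDeriv, heq.fderiv_eq, h.fderiv]
  rfl

theorem secondForm_graphParam {F : (Fin n → ℝ) → ℝ} {x : Fin n → ℝ} (hF : ContDiffAt ℝ 2 F x) :
    secondForm (graphParam F) (graphNormal F) x = (√(1 + ∑ i, partialDeriv i F x ^ 2))⁻¹ •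
      Matrix.of fun i j => partialDeriv i (partialDeriv j F) x := by
  ext i j
  simp [secondForm, partialDeriv_partialDeriv_graphParam hF, graphNormal_eq, inner_smul_left,
    inner_snocEquiv]

theorem partialDeriv_translationFun {f : Fin n → ℝ → ℝ} {x : Fin n → ℝ}
    (hf : ∀ i, DifferentiableAt ℝ (f i) (x i)) (i : Fin n) :
    partialDeriv i (translationFun f) x = deriv (f i) (x i) := by
  have h : HasFDerivAt (translationFun f) (∑ l, deriv (f l) (x l) •
      (ContinuousLinearMap.proj l : (Fin n → ℝ) →L[ℝ] ℝ)) x :=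
    HasFDerivAt.fun_sum fun l _ => (hf l).hasDerivAt.comp_hasFDerivAt x (hasFDerivAt_apply l x)
  rw [partialDeriv, h.fderiv]
  simp [Pi.single_apply]

theorem hasDerivAt_deriv_of_contDiffAt {f : ℝ → ℝ} {t : ℝ} (hf : ContDiffAt ℝ 2 f t) :
    HasDerivAt (deriv f) (deriv (deriv f) t) t :=
  ((hf.derivWithin (m := 1) le_rfl).differentiableAt one_ne_zero).hasDerivAt

theorem partialDeriv_partialDeriv_translationFun {f : Fin n → ℝ → ℝ} {x : Fin n → ℝ}
    (hf : ∀ i, ContDiffAt ℝ 2 (f i) (x i)) (i j : Fin n) :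
    partialDeriv i (partialDeriv j (translationFun f)) x =
      Matrix.diagonal (fun l => deriv (deriv (f l)) (x l)) i j := by
  have heq : partialDeriv j (translationFun f) =ᶠ[nhds x] fun y => deriv (f j) (y j) := by
    have hev : ∀ᶠ y in nhds x, ∀ l, ContDiffAt ℝ 2 (f l) (y l) :=
      Filter.eventually_all.2 fun l =>
        (continuous_apply l).continuousAt.eventually ((hf l).eventually (by simp))
    filter_upwards [hev] with y hy
    exact partialDeriv_translationFun (fun l => (hy l).differentiableAt two_ne_zero) j
  have h : HasFDerivAt (fun y : Fin n → ℝ => deriv (f j) (y j)) (deriv (deriv (f j)) (x j) •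
      (ContinuousLinearMap.proj j : (Fin n → ℝ) →L[ℝ] ℝ)) x :=
    (hasDerivAt_deriv_of_contDiffAt (hf j)).comp_hasFDerivAt (f := fun y : Fin n → ℝ => y j) x
      (hasFDerivAt_apply j x)
  rw [partialDeriv, heq.fderiv_eq, h.fderiv]
  simp only [Matrix.diagonal_apply, _root_.smul_apply, ContinuousLinearMap.proj_apply,
    Pi.single_apply, smul_eq_mul, mul_ite, mul_one, mul_zero]
  grind

theorem contDiffAt_translationFun {f : Fin n → ℝ → ℝ} {x : Fin n → ℝ} {k : WithTop ℕ∞}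
    (hf : ∀ i, ContDiffAt ℝ k (f i) (x i)) : ContDiffAt ℝ k (translationFun f) x :=
  ContDiffAt.sum fun i _ => (hf i).comp x (contDiff_apply ℝ ℝ i).contDiffAt

theorem graphCurvature_translationFun {r : ℕ} (hr : r < n) {f : Fin n → ℝ → ℝ} {x : Fin n → ℝ}
    (hf : ∀ i, ContDiffAt ℝ 2 (f i) (x i)) :
    √(1 + ∑ i, deriv (f i) (x i) ^ 2) ^ (r + 2) * graphCurvature r (translationFun f) x =
      mixedSum r univ 1 (fun i => deriv (deriv (f i)) (x i)) fun i => deriv (f i) (x i) ^ 2 := by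
  have hF := contDiffAt_translationFun hf
  have hpos : 0 < 1 + ∑ i, deriv (f i) (x i) ^ 2 := by positivity
  set p : Fin n → ℝ := fun i => deriv (f i) (x i)
  set κ : Fin n → ℝ := fun i => deriv (deriv (f i)) (x i)
  set W := √(1 + ∑ i, p i ^ 2)
  have hW0 : W ≠ 0 := (Real.sqrt_pos.2 hpos).ne'
  have hW2 : W ^ 2 = 1 + ∑ i, p i * p i := by rw [Real.sq_sqrt hpos.le]; simp only [p, sq]
  have hp : ∀ i, partialDeriv i (translationFun f) x = p i :=
    partialDeriv_translationFun fun i => (hf i).differentiableAt two_ne_zero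
  have hshape : shapeMatrix (graphParam (translationFun f)) (graphNormal (translationFun f)) x =
      W⁻¹ • ((1 + Matrix.vecMulVec p p)⁻¹ * Matrix.diagonal κ) := by
    rw [shapeMatrix, firstForm_graphParam (hF.differentiableAt two_ne_zero),
      secondForm_graphParam hF]
    simp only [hp, partialDeriv_partialDeriv_translationFun hf, Matrix.mul_smul]
    rfl
  have hcoeff := coeff_charpoly_inv_one_add_vecMulVec_mul_diagonal (m := Fin n) (by simpa using hr)
    (hW2 ▸ (pow_ne_zero 2 hW0).isUnit) κ
  have hscale := coeff_charpoly_smul (m := Fin n) (by simpa using hr.le) W⁻¹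
    ((1 + Matrix.vecMulVec p p)⁻¹ * Matrix.diagonal κ)
  rw [Fintype.card_fin] at hcoeff hscale
  have hsign : (-1 : ℝ) ^ r * (-1) ^ r = 1 := by rw [← mul_pow]; norm_num
  have hW : W ^ (r + 2) * W⁻¹ ^ r = W ^ 2 := by rw [pow_add, inv_pow]; field_simp
  simp only [sq (deriv _ _)]
  rw [graphCurvature, curvature, hshape, hscale]
  linear_combination
    (-1) ^ r * ((1 + Matrix.vecMulVec p p)⁻¹ * Matrix.diagonal κ).charpoly.coeff (n - r) *
      (hW + hW2) + (-1) ^ r * hcoeff +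
    mixedSum r univ 1 κ (fun i => p i * p i) * hsign

theorem graphCurvature_translationFun_eq_zero_iff {r : ℕ} (hr : r < n) {f : Fin n → ℝ → ℝ}
    {x : Fin n → ℝ} (hf : ∀ i, ContDiffAt ℝ 2 (f i) (x i)) :
    graphCurvature r (translationFun f) x = 0 ↔
      mixedSum r univ 1 (fun i => deriv (deriv (f i)) (x i))
        (fun i => deriv (f i) (x i) ^ 2) = 0 := by
  have hW : √(1 + ∑ i, deriv (f i) (x i) ^ 2) ^ (r + 2) ≠ 0 :=
    pow_ne_zero _ (Real.sqrt_pos.2 (by positivity)).ne'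
  rw [← graphCurvature_translationFun hr hf, mul_eq_zero, or_iff_right hW]

end Graph

section Invariance

variable {n : ℕ}

local notation "𝔼" => EuclideanSpace ℝ (Fin (n + 1))

theorem partialDeriv_linearIsometryEquiv_add {E E' : Type*} [NormedAddCommGroup E]
    [NormedSpace ℝ E] [NormedAddCommGroup E'] [NormedSpace ℝ E'] (L : E ≃ₗᵢ[ℝ] E') (b : E')
    (X : (Fin n → ℝ) → E) (i : Fin n) :
    partialDeriv i (fun z => L (X z) + b) = fun z => L (partialDeriv i X z) := by
  ext z
  rw [partialDeriv, fderiv_add_const]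
  exact DFunLike.congr_fun (L.comp_fderiv (f := X)) _

theorem curvature_linearIsometryEquiv_add (r : ℕ) (L : 𝔼 ≃ₗᵢ[ℝ] 𝔼) (b : 𝔼)
    (X N : (Fin n → ℝ) → 𝔼) (x : Fin n → ℝ) :
    curvature r (fun z => L (X z) + b) (fun z => L (N z)) x = curvature r X N x := by
  have hpd2 : ∀ i j, partialDeriv i (fun z => L (partialDeriv j X z)) x =
      L (partialDeriv i (partialDeriv j X) x) := fun i j => by
    simpa using congrFun (partialDeriv_linearIsometryEquiv_add L 0 (partialDeriv j X) i) x
  simp only [curvature, shapeMatrix, firstForm, secondForm, hpd2, L.inner_map_map,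
    partialDeriv_linearIsometryEquiv_add]

theorem curvature_congr (r : ℕ) {X X' N N' : (Fin n → ℝ) → 𝔼} {x : Fin n → ℝ}
    (hX : X =ᶠ[nhds x] X') (hN : N x = N' x) : curvature r X N x = curvature r X' N' x := by
  have hpd : ∀ i, partialDeriv i X =ᶠ[nhds x] partialDeriv i X' := fun i =>
    hX.fderiv.fun_comp (· (Pi.single i 1))
  have hpd2 : ∀ i j, partialDeriv i (partialDeriv j X) x = partialDeriv i (partialDeriv j X') x :=
    fun i j => DFunLike.congr_fun (hpd j).fderiv_eq _
  simp only [curvature, shapeMatrix, firstForm, secondForm, (hpd _).eq_of_nhds, hpd2, hN]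

theorem curvature_of_normal_eq_smul {r : ℕ} (hr : r ≤ n) (X : (Fin n → ℝ) → 𝔼)
    {N N' : (Fin n → ℝ) → 𝔼} {x : Fin n → ℝ} {c : ℝ} (hN : N' x = c • N x) :
    curvature r X N' x = c ^ r * curvature r X N x := by
  have hsecond : secondForm X N' x = c • secondForm X N x := by
    ext i j
    simp [secondForm, hN, inner_smul_left]
  have hcoeff := coeff_charpoly_smul (m := Fin n) (by simpa using hr) c (shapeMatrix X N x)
  rw [Fintype.card_fin] at hcoeff
  rw [curvature, curvature, shapeMatrix, hsecond, Matrix.mul_smul, ← shapeMatrix, hcoeff]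
  ring

theorem firstForm_eq_toMatrix₂' (X : (Fin n → ℝ) → 𝔼) (x : Fin n → ℝ) :
    firstForm X x = LinearMap.toMatrix₂' ℝ
      ((innerₗ 𝔼).compl₁₂ (fderiv ℝ X x : (Fin n → ℝ) →ₗ[ℝ] 𝔼) (fderiv ℝ X x)) := by
  ext i j
  simp [firstForm, partialDeriv, LinearMap.toMatrix₂'_apply]

theorem partialDeriv_partialDeriv {E : Type*} [NormedAddCommGroup E] [NormedSpace ℝ E]
    {X : (Fin n → ℝ) → E} {x : Fin n → ℝ} (hX : ContDiffAt ℝ 2 X x) (i j : Fin n) :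
    partialDeriv i (partialDeriv j X) x =
      fderiv ℝ (fderiv ℝ X) x (Pi.single i 1) (Pi.single j 1) := by
  have hdiff := (hX.fderiv_right (m := 1) le_rfl).differentiableAt one_ne_zero
  unfold partialDeriv
  rw [fderiv_clm_apply hdiff (differentiableAt_const _)]
  simp

theorem secondForm_eq_toMatrix₂' {X : (Fin n → ℝ) → 𝔼} (N : (Fin n → ℝ) → 𝔼) {x : Fin n → ℝ}
    (hX : ContDiffAt ℝ 2 X x) :
    secondForm X N x = LinearMap.toMatrix₂' ℝ
      ((fderiv ℝ (fderiv ℝ X) x).toLinearMap₁₂.compr₂ (innerₗ 𝔼 (N x))) := by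
  ext i j
  simp [secondForm, partialDeriv_partialDeriv hX, LinearMap.toMatrix₂'_apply]

theorem firstForm_comp {Y : (Fin n → ℝ) → 𝔼} {y : (Fin n → ℝ) → Fin n → ℝ} {x : Fin n → ℝ}
    (hY : DifferentiableAt ℝ Y (y x)) (hy : DifferentiableAt ℝ y x) :
    firstForm (Y ∘ y) x =
      (LinearMap.toMatrix' (fderiv ℝ y x : (Fin n → ℝ) →ₗ[ℝ] Fin n → ℝ)).transpose *
        firstForm Y (y x) *
        LinearMap.toMatrix' (fderiv ℝ y x : (Fin n → ℝ) →ₗ[ℝ] Fin n → ℝ) := by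
  rw [firstForm_eq_toMatrix₂', firstForm_eq_toMatrix₂', ← LinearMap.toMatrix₂'_compl₁₂,
    fderiv_comp x hY hy]
  rfl

theorem secondForm_comp {Y N : (Fin n → ℝ) → 𝔼} {y : (Fin n → ℝ) → Fin n → ℝ} {x : Fin n → ℝ}
    (hY : ContDiffAt ℝ 2 Y (y x)) (hy : ContDiffAt ℝ 2 y x)
    (hN : ∀ v, inner ℝ (N (y x)) (fderiv ℝ Y (y x) v) = 0) :
    secondForm (Y ∘ y) (N ∘ y) x =
      (LinearMap.toMatrix' (fderiv ℝ y x : (Fin n → ℝ) →ₗ[ℝ] Fin n → ℝ)).transpose *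
        secondForm Y N (y x) *
        LinearMap.toMatrix' (fderiv ℝ y x : (Fin n → ℝ) →ₗ[ℝ] Fin n → ℝ) := by
  have heq : fderiv ℝ (Y ∘ y) =ᶠ[nhds x] fun z => (fderiv ℝ Y (y z)).comp (fderiv ℝ y z) := by
    filter_upwards [hy.eventually (by simp),
      hy.continuousAt.eventually (hY.eventually (by simp))] with z hyz hYz
    exact fderiv_comp z (hYz.differentiableAt two_ne_zero) (hyz.differentiableAt two_ne_zero)
  have hDY := (hY.fderiv_right (m := 1) le_rfl).differentiableAt one_ne_zero
  have hDy := (hy.fderiv_right (m := 1) le_rfl).differentiableAt one_ne_zero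
  have hdy := hy.differentiableAt two_ne_zero
  rw [secondForm_eq_toMatrix₂' _ (hY.comp x hy), secondForm_eq_toMatrix₂' _ hY,
    ← LinearMap.toMatrix₂'_compl₁₂, heq.fderiv_eq, fderiv_clm_comp (hDY.fun_comp' x hdy) hDy,
    fderiv_fun_comp x hDY hdy]
  congr 1
  ext v w
  simp [inner_add_right, hN]

theorem curvature_comp (r : ℕ) {Y N : (Fin n → ℝ) → 𝔼} {y : (Fin n → ℝ) → Fin n → ℝ}
    {x : Fin n → ℝ} (hY : ContDiffAt ℝ 2 Y (y x)) (hy : ContDiffAt ℝ 2 y x)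
    (hN : ∀ v, inner ℝ (N (y x)) (fderiv ℝ Y (y x) v) = 0)
    (hinj : Injective (fderiv ℝ y x)) :
    curvature r (Y ∘ y) (N ∘ y) x = curvature r Y N (y x) := by
  have hfirst := firstForm_comp (hY.differentiableAt two_ne_zero) (hy.differentiableAt two_ne_zero)
  have hsecond := secondForm_comp hY hy hN
  set P := LinearMap.toMatrix' (fderiv ℝ y x : (Fin n → ℝ) →ₗ[ℝ] Fin n → ℝ)
  have hP : IsUnit P.det := by
    rw [LinearMap.det_toMatrix', ← LinearMap.isUnit_iff_isUnit_det, LinearMap.isUnit_iff_ker_eq_bot]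
    exact LinearMap.ker_eq_bot.2 hinj
  have hshape : shapeMatrix (Y ∘ y) (N ∘ y) x = P⁻¹ * (shapeMatrix Y N (y x) * P) := by
    rw [shapeMatrix, hfirst, hsecond, shapeMatrix, Matrix.mul_inv_rev, Matrix.mul_inv_rev]
    simp only [Matrix.mul_assoc]
    rw [Matrix.nonsing_inv_mul_cancel_left _ _ (Matrix.isUnit_det_transpose P hP)]
  rw [curvature, hshape, Matrix.charpoly_mul_comm, Matrix.mul_assoc, Matrix.mul_nonsing_inv P hP,
    mul_one, curvature]


theorem norm_graphNormal (F : (Fin n → ℝ) → ℝ) (x : Fin n → ℝ) : ‖graphNormal F x‖ = 1 := by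
  have hnorm : ‖snocEquiv n (fun i => -partialDeriv i F x, 1)‖ =
      √(1 + ∑ i, partialDeriv i F x ^ 2) := by
    rw [norm_eq_sqrt_real_inner, inner_snocEquiv, add_comm]
    simp [sq]
  have hpos : 0 < √(1 + ∑ i, partialDeriv i F x ^ 2) := Real.sqrt_pos.2 (by positivity)
  rw [graphNormal_eq, norm_smul, hnorm, norm_inv, Real.norm_of_nonneg hpos.le,
    inv_mul_cancel₀ hpos.ne']

theorem inner_graphNormal_fderiv {F : (Fin n → ℝ) → ℝ} {x : Fin n → ℝ}
    (hF : DifferentiableAt ℝ F x) (v : Fin n → ℝ) :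
    inner ℝ (graphNormal F x) (fderiv ℝ (graphParam F) x v) = 0 := by
  have hv : fderiv ℝ F x v = ∑ i, v i * partialDeriv i F x := by
    conv_lhs => rw [pi_eq_sum_univ' v]
    simp [partialDeriv]
  rw [fderiv_graphParam hF, graphNormal_eq, inner_smul_left, inner_snocEquiv, hv]
  simp [mul_comm]

theorem exists_eq_smul_graphNormal {F : (Fin n → ℝ) → ℝ} {x : Fin n → ℝ}
    (hF : DifferentiableAt ℝ F x) {z : 𝔼}
    (hz : ∀ v, inner ℝ z (fderiv ℝ (graphParam F) x v) = 0) :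
    ∃ c : ℝ, z = c • graphNormal F x := by
  obtain ⟨⟨u, a⟩, rfl⟩ := (snocEquiv n).surjective z
  have hu : u = fun i => a * -partialDeriv i F x := by
    ext i
    have hi := hz (Pi.single i 1)
    rw [fderiv_graphParam hF, inner_snocEquiv, ← partialDeriv] at hi
    simp only [Pi.single_apply, mul_ite, mul_one, mul_zero, sum_ite_eq', mem_univ, if_true] at hi
    linarith
  have hpos : 0 < √(1 + ∑ i, partialDeriv i F x ^ 2) := Real.sqrt_pos.2 (by positivity)
  refine ⟨a * √(1 + ∑ i, partialDeriv i F x ^ 2), ?_⟩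
  rw [graphNormal_eq, smul_smul, mul_inv_cancel_right₀ hpos.ne', ← map_smul, hu]
  simp [Prod.smul_mk, Pi.smul_def]

theorem exists_graphCurvature_eq_pow_mul {r : ℕ} (hr : r ≤ n) (L : 𝔼 ≃ₗᵢ[ℝ] 𝔼) (b : 𝔼)
    {F G : (Fin n → ℝ) → ℝ} {y : (Fin n → ℝ) → Fin n → ℝ} {x : Fin n → ℝ}
    (hF : DifferentiableAt ℝ F x) (hG : ContDiffAt ℝ 2 G (y x)) (hy : ContDiffAt ℝ 2 y x)
    (h : ∀ᶠ z in nhds x, graphParam G (y z) = L (graphParam F z) + b) :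
    ∃ c : ℝ, c ≠ 0 ∧ graphCurvature r G (y x) = c ^ r * graphCurvature r F x := by
  have heq : graphParam G ∘ y =ᶠ[nhds x] fun z => L (graphParam F z) + b := h
  have hdG := hG.differentiableAt two_ne_zero
  have hGp : ContDiffAt ℝ 2 (graphParam G) (y x) :=
    (snocEquiv n).contDiff.contDiffAt.comp (y x) (contDiffAt_id.prodMk hG)
  have hfderiv : ∀ v, fderiv ℝ (graphParam G) (y x) (fderiv ℝ y x v) =
      L (fderiv ℝ (graphParam F) x v) := fun v => by
    have hcomp := fderiv_comp x (hGp.differentiableAt two_ne_zero) (hy.differentiableAt two_ne_zero)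
    rw [heq.fderiv_eq, fderiv_add_const] at hcomp
    exact DFunLike.congr_fun (hcomp.symm.trans (L.comp_fderiv (f := graphParam F))) v
  have hinj : Injective (fderiv ℝ y x) := by
    refine (injective_iff_map_eq_zero _).2 fun v hv => ?_
    have hv0 := hfderiv v
    rw [hv, map_zero, eq_comm, map_eq_zero_iff L L.injective, fderiv_graphParam hF,
      map_eq_zero_iff (snocEquiv n) (snocEquiv n).injective] at hv0
    exact congrArg Prod.fst hv0
  obtain ⟨c, hc⟩ : ∃ c : ℝ, L.symm (graphNormal G (y x)) = c • graphNormal F x := by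
    refine exists_eq_smul_graphNormal hF fun v => ?_
    rw [← L.inner_map_map, L.apply_symm_apply, ← hfderiv]
    exact inner_graphNormal_fderiv hdG _
  refine ⟨c, ?_, ?_⟩
  · rintro rfl
    have hnorm := norm_graphNormal G (y x)
    rw [← L.symm.norm_map, hc, zero_smul, norm_zero] at hnorm
    exact zero_ne_one hnorm
  · have hnormal : (graphNormal G ∘ y) x = c • L (graphNormal F x) := by
      rw [← map_smul, ← hc, L.apply_symm_apply, comp_apply]
    rw [graphCurvature, ← curvature_comp r hGp hy (inner_graphNormal_fderiv hdG) hinj,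
      curvature_congr r heq rfl, curvature_of_normal_eq_smul hr _
        (N := fun z => L (graphNormal F z)) hnormal,
      curvature_linearIsometryEquiv_add, graphCurvature]

theorem exists_linearIsometryEquiv_add (φ : 𝔼 ≃ᵢ 𝔼) :
    ∃ (L : 𝔼 ≃ₗᵢ[ℝ] 𝔼) (b : 𝔼), ∀ z, φ z = L z + b :=
  ⟨φ.toRealAffineIsometryEquiv.linearIsometryEquiv, φ 0, fun z => by
    simpa using φ.toRealAffineIsometryEquiv.map_vadd 0 z⟩

theorem graphCurvature_eq_zero_of_isometry {r : ℕ} (hr : r ≤ n) {F G : (Fin n → ℝ) → ℝ}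
    {Ω Ω' : Set (Fin n → ℝ)} (hΩ : IsOpen Ω) (hF : ∀ x ∈ Ω, ContDiffAt ℝ 2 F x)
    (hG : ∀ y ∈ Ω', ContDiffAt ℝ 2 G y) (φ : 𝔼 ≃ᵢ 𝔼)
    (hφ : φ '' graphOver F Ω ⊆ graphOver G Ω') (hzero : ∀ y ∈ Ω', graphCurvature r G y = 0)
    {x : Fin n → ℝ} (hx : x ∈ Ω) : graphCurvature r F x = 0 := by
  obtain ⟨L, b, hL⟩ := exists_linearIsometryEquiv_add φ
  set y : (Fin n → ℝ) → Fin n → ℝ := fun z => ((snocEquiv n).symm (L (graphParam F z) + b)).1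
  have hyφ : ∀ z ∈ Ω, y z ∈ Ω' ∧ graphParam G (y z) = L (graphParam F z) + b := fun z hz => by
    obtain ⟨u, hu, hu'⟩ := hφ ⟨graphParam F z, ⟨z, hz, rfl⟩, rfl⟩
    rw [hL] at hu'
    have hyu : y z = u := by
      simp only [y, ← hu', graphParam_eq G, (snocEquiv n).symm_apply_apply]
    exact hyu ▸ ⟨hu, hu'⟩
  have hy : ContDiffAt ℝ 2 y x :=
    (contDiff_fst.comp (snocEquiv n).symm.contDiff).contDiffAt.comp x
      ((L.contDiff.contDiffAt.comp x ((snocEquiv n).contDiff.contDiffAt.comp x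
        (contDiffAt_id.prodMk (hF x hx)))).add contDiffAt_const)
  obtain ⟨c, hc, hcurv⟩ := exists_graphCurvature_eq_pow_mul hr L b
    ((hF x hx).differentiableAt two_ne_zero) (hG _ (hyφ x hx).1) hy
    (Filter.eventually_of_mem (hΩ.mem_nhds hx) fun z hz => (hyφ z hz).2)
  rw [hzero _ (hyφ x hx).1, zero_eq_mul] at hcurv
  exact hcurv.resolve_left (pow_ne_zero r hc)

end Invariance

section OneVariable

open Real

variable {J : Set ℝ} {f f' : ℝ → ℝ} {a b β t : ℝ}

/-- `f` agrees on `J` with an affine function of slope `a`. -/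
def IsAffineOn (a : ℝ) (f : ℝ → ℝ) (J : Set ℝ) : Prop := ∃ d, ∀ t ∈ J, f t = a * t + d

/-- On `J`, `f` has the form `-a⁻¹ log (cos (a √β t + b)) + d` of a summand of a generalized
periodic Enneper hypersurface. -/
def IsLogCosOn (a β : ℝ) (f : ℝ → ℝ) (J : Set ℝ) : Prop :=
  ∃ b d, ∀ t ∈ J, |a * √β * t + b| < π / 2 ∧ f t = -a⁻¹ * log (cos (a * √β * t + b)) + d

theorem cos_pos_of_abs_lt {θ : ℝ} (h : |θ| < π / 2) : 0 < cos θ :=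
  cos_pos_of_mem_Ioo (abs_lt.1 h)

theorem hasDerivAt_mul_add : HasDerivAt (fun t => a * t + b) a t := by
  simpa using ((hasDerivAt_id t).const_mul a).add_const b

theorem hasDerivAt_log_cos (ha : a ≠ 0) (ht : |a * √β * t + b| < π / 2) :
    HasDerivAt (fun t => -a⁻¹ * log (cos (a * √β * t + b))) (√β * tan (a * √β * t + b)) t := by
  convert! (hasDerivAt_mul_add.cos.log (cos_pos_of_abs_lt ht).ne').const_mul (-a⁻¹) using 1
  rw [tan_eq_sin_div_cos]
  field_simp

theorem hasDerivAt_sqrt_mul_tan (hβ : 0 ≤ β) (ht : |a * √β * t + b| < π / 2) :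
    HasDerivAt (fun t => √β * tan (a * √β * t + b))
      (a * (β + (√β * tan (a * √β * t + b)) ^ 2)) t := by
  have hcos := (cos_pos_of_abs_lt ht).ne'
  convert! ((hasDerivAt_tan hcos).comp t hasDerivAt_mul_add).const_mul √β using 1
  rw [← inv_one_add_tan_sq hcos, one_div, inv_inv, mul_pow, sq_sqrt hβ]
  linear_combination -(a * (1 + tan (a * √β * t + b) ^ 2)) * sq_sqrt hβ

theorem contDiffOn_log_cos {k : WithTop ℕ∞} (h : ∀ t ∈ J, |a * √β * t + b| < π / 2) :
    ContDiffOn ℝ k (fun t => -a⁻¹ * log (cos (a * √β * t + b))) J :=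
  contDiffOn_const.mul <|
    (contDiff_cos.comp (by fun_prop : ContDiff ℝ k fun t => a * √β * t + b)).contDiffOn.log
      fun t ht => (cos_pos_of_abs_lt (h t ht)).ne'

theorem IsAffineOn.contDiffOn {k : WithTop ℕ∞} (hf : IsAffineOn a f J) : ContDiffOn ℝ k f J := by
  obtain ⟨d, hd⟩ := hf
  exact (by fun_prop : ContDiffOn ℝ k (fun t => a * t + d) J).congr hd

theorem IsLogCosOn.contDiffOn {k : WithTop ℕ∞} (hf : IsLogCosOn a β f J) :
    ContDiffOn ℝ k f J := by
  obtain ⟨b, d, hbd⟩ := hf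
  exact ((contDiffOn_log_cos fun t ht => (hbd t ht).1).add contDiffOn_const).congr
    fun t ht => (hbd t ht).2

theorem IsAffineOn.deriv_eqOn (hf : IsAffineOn a f J) (hJ : IsOpen J) :
    J.EqOn (deriv f) fun _ => a := by
  obtain ⟨d, hd⟩ := hf
  exact (Set.EqOn.deriv hd hJ).trans fun t _ => hasDerivAt_mul_add.deriv

theorem IsAffineOn.deriv_deriv_eqOn_zero (hf : IsAffineOn a f J) (hJ : IsOpen J) :
    J.EqOn (deriv (deriv f)) 0 :=
  ((hf.deriv_eqOn hJ).deriv hJ).trans fun t _ => deriv_const t a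

theorem IsLogCosOn.deriv_deriv_eq (hf : IsLogCosOn a β f J) (hJ : IsOpen J) (ha : a ≠ 0)
    (hβ : 0 ≤ β) (ht : t ∈ J) : deriv (deriv f) t = a * (β + deriv f t ^ 2) := by
  obtain ⟨b, d, hbd⟩ := hf
  have hderiv : J.EqOn (deriv f) fun t => √β * tan (a * √β * t + b) := fun t ht =>
    ((hasDerivAt_log_cos ha (hbd t ht).1).add_const d |>.congr_of_eventuallyEq <| by
      filter_upwards [hJ.mem_nhds ht] with s hs using (hbd s hs).2).deriv
  rw [hderiv.deriv hJ ht, hderiv ht, (hasDerivAt_sqrt_mul_tan hβ (hbd t ht).1).deriv]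

theorem IsOpenInterval.exists_const_of_hasDerivAt_zero (hJ : IsOpenInterval J)
    (hf : ∀ t ∈ J, HasDerivAt f 0 t) : ∃ d, ∀ t ∈ J, f t = d :=
  hJ.1.exists_is_const_of_deriv_eq_zero hJ.2.1.isPreconnected
    (fun t ht => (hf t ht).differentiableAt.differentiableWithinAt) fun t ht => (hf t ht).deriv

theorem IsOpenInterval.exists_isAffineOn (hJ : IsOpenInterval J)
    (hf : ∀ t ∈ J, HasDerivAt f (f' t) t) (hf' : ∀ t ∈ J, HasDerivAt f' 0 t) :
    ∃ a, IsAffineOn a f J := by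
  obtain ⟨a, ha⟩ := hJ.exists_const_of_hasDerivAt_zero hf'
  obtain ⟨d, hd⟩ := hJ.exists_const_of_hasDerivAt_zero (f := fun t => f t - a * t) fun t ht => by
    simpa [ha t ht] using (hf t ht).fun_sub ((hasDerivAt_id t).const_mul a)
  exact ⟨a, d, fun t ht => by linarith [hd t ht]⟩

-- The equation says that `arctan (f' / √β)` has constant slope `a √β`.
theorem IsOpenInterval.isLogCosOn (hJ : IsOpenInterval J) (ha : a ≠ 0)
    (hβ : 0 < β) (hf : ∀ t ∈ J, HasDerivAt f (f' t) t)
    (hf' : ∀ t ∈ J, HasDerivAt f' (a * (β + f' t ^ 2)) t) :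
    IsLogCosOn a β f J := by
  have hs : √β ≠ 0 := (sqrt_pos.2 hβ).ne'
  obtain ⟨b, hb⟩ := hJ.exists_const_of_hasDerivAt_zero
    (f := fun t => arctan (f' t / √β) - a * √β * t) fun t ht => by
      convert! ((hf' t ht).div_const √β).arctan.fun_sub
        ((hasDerivAt_id t).const_mul (a * √β)) using 1
      have hne : β + f' t ^ 2 ≠ 0 := by positivity
      rw [div_pow, sq_sqrt hβ.le]
      field_simp [hne]
      rw [sq_sqrt hβ.le]
      ring
  have harg : ∀ t ∈ J, a * √β * t + b = arctan (f' t / √β) := fun t ht => by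
    linarith [hb t ht]
  have habs : ∀ t ∈ J, |a * √β * t + b| < π / 2 := fun t ht => by
    rw [harg t ht, abs_lt]
    exact ⟨neg_pi_div_two_lt_arctan _, arctan_lt_pi_div_two _⟩
  obtain ⟨d, hd⟩ := hJ.exists_const_of_hasDerivAt_zero
    (f := fun t => f t - -a⁻¹ * log (cos (a * √β * t + b))) fun t ht => by
      have htan : √β * tan (a * √β * t + b) = f' t := by
        rw [harg t ht, tan_arctan, mul_div_cancel₀ _ hs]
      simpa only [htan, sub_self] using (hf t ht).fun_sub (hasDerivAt_log_cos ha (habs t ht))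
  exact ⟨b, d, fun t ht => ⟨habs t ht, by linarith [hd t ht]⟩⟩

theorem exists_mem_sq_ne_of_deriv_ne_zero (hJ : J ∈ nhds t) (h : deriv f t ≠ 0) :
    ∃ s ∈ J, f s ^ 2 ≠ f t ^ 2 := by
  have hft := (differentiableAt_of_deriv_ne_zero h).hasDerivAt
  obtain ⟨s, ⟨hpos, hneg⟩, hs⟩ := ((hft.eventually_ne (c := f t) h).and
    (hft.eventually_ne (c := -f t) h) |>.and (nhdsWithin_le_nhds hJ)).exists
  exact ⟨s, hs, fun hsq => (sq_eq_sq_iff_eq_or_eq_neg.1 hsq).elim hpos hneg⟩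

theorem IsOpenInterval.exists_isAffineOn_or_exists_deriv_ne (hJ : IsOpenInterval J)
    (hf : ∀ t ∈ J, ContDiffAt ℝ 2 f t) : (∃ a, IsAffineOn a f J) ∨
      ∃ s ∈ J, ∃ t ∈ J, deriv (deriv f) s ≠ 0 ∧ deriv f s ^ 2 ≠ deriv f t ^ 2 := by
  by_cases hf'' : ∃ s ∈ J, deriv (deriv f) s ≠ 0
  · obtain ⟨s, hs, hne⟩ := hf''
    obtain ⟨t, ht, hst⟩ := exists_mem_sq_ne_of_deriv_ne_zero (hJ.1.mem_nhds hs) hne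
    exact .inr ⟨s, hs, t, ht, hne, hst.symm⟩
  · push Not at hf''
    exact .inl <| hJ.exists_isAffineOn
      (fun t ht => ((hf t ht).differentiableAt two_ne_zero).hasDerivAt)
      fun t ht => hf'' t ht ▸ hasDerivAt_deriv_of_contDiffAt (hf t ht)

end OneVariable

section Profile

variable {n r : ℕ} {A B : Finset (Fin n)} {a : Fin n → ℝ} {J : Fin n → Set ℝ} {f : Fin n → ℝ → ℝ}

/-- The summands `f i` of a translation function are those of a generalized periodic Enneper
hypersurface, up to the order of the variables: affine of slope `a i` for `i ∉ A`, and solutions of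
`y'' = a i * (β + y' ^ 2)` for `i ∈ A`. -/
structure IsEnneperProfile (A : Finset (Fin n)) (a : Fin n → ℝ) (J : Fin n → Set ℝ)
    (f : Fin n → ℝ → ℝ) : Prop where
  ne_zero : ∀ i ∈ A, a i ≠ 0
  sum_inv_eq_zero : ∑ i ∈ A, (a i)⁻¹ = 0
  isAffineOn : ∀ i ∉ A, IsAffineOn (a i) (f i) (J i)
  isLogCosOn : ∀ i ∈ A, IsLogCosOn (a i) (1 + ∑ m ∈ Aᶜ, a m ^ 2) (f i) (J i)

theorem IsEnneperProfile.contDiffOn {k : WithTop ℕ∞} (hf : IsEnneperProfile A a J f) (i : Fin n) :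
    ContDiffOn ℝ k (f i) (J i) := by
  by_cases hi : i ∈ A
  · exact (hf.isLogCosOn i hi).contDiffOn
  · exact (hf.isAffineOn i hi).contDiffOn

theorem IsEnneperProfile.comp_perm (hf : IsEnneperProfile A a J f) {σ : Equiv.Perm (Fin n)}
    (hσ : ∀ i, σ i ∈ A ↔ i ∈ B) :
    IsEnneperProfile B (fun i => a (σ i)) (fun i => J (σ i)) fun i => f (σ i) where
  ne_zero i hi := hf.ne_zero _ ((hσ i).2 hi)
  sum_inv_eq_zero := by
    rw [← hf.sum_inv_eq_zero]
    exact sum_equiv σ (fun i => (hσ i).symm) fun _ _ => rfl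
  isAffineOn i hi := hf.isAffineOn _ ((hσ i).not.2 hi)
  isLogCosOn i hi := by
    rw [sum_equiv σ (t := Aᶜ) (g := fun m => a m ^ 2) (by simp [hσ]) fun _ _ => rfl]
    exact hf.isLogCosOn _ ((hσ i).2 hi)

theorem graphCurvature_translationFun_eq_zero_iff_of_isAffineOn (hr : r < n)
    (hJ : ∀ i, IsOpen (J i)) (hf : ∀ i, ∀ t ∈ J i, ContDiffAt ℝ 2 (f i) t)
    (haff : ∀ i ∉ A, IsAffineOn (a i) (f i) (J i)) {x : Fin n → ℝ} (hx : x ∈ Set.univ.pi J) :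
    graphCurvature r (translationFun f) x = 0 ↔
      mixedSum r A (1 + ∑ m ∈ Aᶜ, a m ^ 2) (fun i => deriv (deriv (f i)) (x i))
        (fun i => deriv (f i) (x i) ^ 2) = 0 := by
  have hxJ : ∀ i, x i ∈ J i := fun i => hx i (Set.mem_univ i)
  rw [graphCurvature_translationFun_eq_zero_iff hr fun i => hf i _ (hxJ i),
    mixedSum_of_subset (subset_univ A) fun i _ hi =>
      (haff i hi).deriv_deriv_eqOn_zero (hJ i) (hxJ i), ← compl_eq_univ_sdiff,
    sum_congr rfl fun i hi => by
      rw [(haff i (mem_compl.1 hi)).deriv_eqOn (hJ i) (hxJ i)]]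

theorem graphCurvature_eq_zero_of_card_lt (hr : r < n) (hJ : ∀ i, IsOpen (J i))
    (hf : ∀ i, ∀ t ∈ J i, ContDiffAt ℝ 2 (f i) t) (hA : #A < r)
    (haff : ∀ i ∉ A, ∃ a, IsAffineOn a (f i) (J i)) {x : Fin n → ℝ} (hx : x ∈ Set.univ.pi J) :
    graphCurvature r (translationFun f) x = 0 := by
  choose! a ha using haff
  rw [graphCurvature_translationFun_eq_zero_iff_of_isAffineOn hr hJ hf ha hx,
    mixedSum_of_card_lt hA]

theorem IsEnneperProfile.graphCurvature_eq_zero (hf : IsEnneperProfile A a J f) (hr : r < n)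
    (hA : #A = r + 1) (hJ : ∀ i, IsOpen (J i)) {x : Fin n → ℝ} (hx : x ∈ Set.univ.pi J) :
    graphCurvature r (translationFun f) x = 0 := by
  have hf2 : ∀ i, ∀ t ∈ J i, ContDiffAt ℝ 2 (f i) t := fun i t ht =>
    (hf.contDiffOn i).contDiffAt ((hJ i).mem_nhds ht)
  rw [graphCurvature_translationFun_eq_zero_iff_of_isAffineOn hr hJ hf2 hf.isAffineOn hx]
  exact mixedSum_eq_zero_of_proportional hA hf.ne_zero hf.sum_inv_eq_zero fun i hi =>
    (hf.isLogCosOn i hi).deriv_deriv_eq (hJ i) (hf.ne_zero i hi) (by positivity)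
      (hx i (Set.mem_univ i))

theorem isEnneperProfile_piecewise {c : Fin n → ℝ} (hJ : ∀ i, IsOpenInterval (J i))
    (hf : ∀ i, ∀ t ∈ J i, ContDiffAt ℝ 2 (f i) t) (haff : ∀ i ∉ A, IsAffineOn (a i) (f i) (J i))
    (hsum : ∑ i ∈ A, (c i)⁻¹ = 0) (hc : ∀ i ∈ A, c i ≠ 0 ∧ ∀ t ∈ J i,
      deriv (deriv (f i)) t = c i * (1 + ∑ m ∈ Aᶜ, a m ^ 2 + deriv (f i) t ^ 2)) :
    IsEnneperProfile A (A.piecewise c a) J f := by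
  have hcA : ∀ i ∈ A, A.piecewise c a i = c i := fun i => piecewise_eq_of_mem A c a
  have haA : ∀ i ∉ A, A.piecewise c a i = a i := fun i => piecewise_eq_of_notMem A c a
  have hβA : ∑ m ∈ Aᶜ, A.piecewise c a m ^ 2 = ∑ m ∈ Aᶜ, a m ^ 2 :=
    sum_congr rfl fun i hi => by rw [haA i (mem_compl.1 hi)]
  refine ⟨fun i hi => hcA i hi ▸ (hc i hi).1, ?_, fun i hi => haA i hi ▸ haff i hi,
    fun i hi => ?_⟩
  · rwa [sum_congr rfl fun i hi => by rw [hcA i hi]]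
  · rw [hcA i hi, hβA]
    exact (hJ i).isLogCosOn (hc i hi).1 (by positivity)
      (fun t ht => ((hf i t ht).differentiableAt two_ne_zero).hasDerivAt)
      fun t ht => (hc i hi).2 t ht ▸ hasDerivAt_deriv_of_contDiffAt (hf i t ht)

theorem forall_graphCurvature_translationFun_eq_zero_iff (hr : r < n)
    (hJ : ∀ i, IsOpenInterval (J i)) (hf : ∀ i, ∀ t ∈ J i, ContDiffAt ℝ 2 (f i) t) :
    (∀ x ∈ Set.univ.pi J, graphCurvature r (translationFun f) x = 0) ↔
      (∃ A : Finset (Fin n), #A < r ∧ ∀ i ∉ A, ∃ a, IsAffineOn a (f i) (J i)) ∨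
        ∃ (A : Finset (Fin n)) (a : Fin n → ℝ), #A = r + 1 ∧ IsEnneperProfile A a J f := by
  classical
  have hJo : ∀ i, IsOpen (J i) := fun i => (hJ i).1
  constructor
  · intro hzero
    let A : Finset (Fin n) := {i | ¬∃ a, IsAffineOn a (f i) (J i)}
    have haff : ∀ i ∉ A, ∃ a, IsAffineOn a (f i) (J i) := fun i hi => by simpa [A] using hi
    choose! a ha using haff
    have hne : ∀ i ∈ A, ∃ s t : J i, deriv (deriv (f i)) s ≠ 0 ∧
        deriv (f i) s ^ 2 ≠ deriv (f i) t ^ 2 := fun i hi => by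
      obtain ⟨s, hs, t, ht, hst⟩ :=
        ((hJ i).exists_isAffineOn_or_exists_deriv_ne (hf i)).resolve_left (mem_filter.1 hi).2
      exact ⟨⟨s, hs⟩, ⟨t, ht⟩, hst⟩
    have hβ : 0 < 1 + ∑ m ∈ Aᶜ, a m ^ 2 := by positivity
    have : ∀ i, Nonempty (J i) := fun i => (hJ i).2.2.to_subtype
    obtain hlt | ⟨hcard, c, hsum, hc⟩ := (forall_mixedSum_eq_zero_iff (r := r) hβ.ne'
      (h := fun i (t : J i) => deriv (deriv (f i)) t) (w := fun i t => deriv (f i) t ^ 2)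
      hne fun i _ t => (by positivity)).1 fun x =>
        (graphCurvature_translationFun_eq_zero_iff_of_isAffineOn hr hJo hf ha
          fun i _ => (x i).2).1 (hzero _ fun i _ => (x i).2)
    · exact .inl ⟨A, hlt, fun i hi => ⟨a i, ha i hi⟩⟩
    · exact .inr ⟨A, A.piecewise c a, hcard, isEnneperProfile_piecewise hJ hf ha hsum
        fun i hi => ⟨(hc i hi).1, fun t ht => (hc i hi).2 ⟨t, ht⟩⟩⟩
  · rintro (⟨A, hA, haff⟩ | ⟨A, a, hA, hprofile⟩) x hx
    · exact graphCurvature_eq_zero_of_card_lt hr hJo hf hA haff hx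
    · exact hprofile.graphCurvature_eq_zero hr hA hJo hx

end Profile

section Congruence

variable {n r : ℕ}

theorem graphOver_congr {F G : (Fin n → ℝ) → ℝ} {Ω : Set (Fin n → ℝ)} (h : Ω.EqOn F G) :
    graphOver F Ω = graphOver G Ω :=
  Set.image_congr fun x hx => by rw [graphParam, graphParam, h hx]

theorem translationFun_add_const_div (hn : n ≠ 0) (f : Fin n → ℝ → ℝ) (c : ℝ) (x : Fin n → ℝ) :
    translationFun (fun i t => f i t + c / n) x = translationFun f x + c := by
  have hc : (n : ℝ) * (c / n) = c := mul_div_cancel₀ _ (Nat.cast_ne_zero.2 hn)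
  simp only [translationFun, sum_add_distrib, sum_const, card_univ, Fintype.card_fin,
    nsmul_eq_mul, hc]

theorem areCongruent_graphOver_comp_perm (σ : Equiv.Perm (Fin n)) (f : Fin n → ℝ → ℝ)
    (J : Fin n → Set ℝ) :
    AreCongruent (graphOver (translationFun f) (Set.univ.pi J))
      (graphOver (translationFun fun i => f (σ i)) (Set.univ.pi fun i => J (σ i))) := by
  let e : Fin (n + 1) ≃ Fin (n + 1) :=
    (finSuccEquivLast.trans (Equiv.optionCongr σ.symm)).trans finSuccEquivLast.symm
  let φ := LinearIsometryEquiv.piLpCongrLeft 2 ℝ ℝ e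
  have hφ : ∀ x, φ (graphParam (translationFun f) x) =
      graphParam (translationFun fun i => f (σ i)) fun i => x (σ i) := fun x => by
    ext i
    have hsum : translationFun (fun i => f (σ i)) (fun i => x (σ i)) = translationFun f x :=
      Equiv.sum_comp σ fun i => f i (x i)
    rw [LinearIsometryEquiv.piLpCongrLeft_apply, graphParam, graphParam, hsum]
    refine Fin.lastCases ?_ (fun i => ?_) i <;> simp [e, Equiv.piCongrLeft']
  have hpi : (fun x i => x (σ i)) '' Set.univ.pi J = Set.univ.pi fun i => J (σ i) := by
    refine Set.eq_of_subset_of_subset ?_ fun x hx => ⟨fun i => x (σ.symm i), fun i _ => ?_, ?_⟩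
    · rintro _ ⟨x, hx, rfl⟩ i _
      exact hx (σ i) (Set.mem_univ _)
    · simpa using hx (σ.symm i) (Set.mem_univ _)
    · simp
  refine ⟨φ.toIsometryEquiv, ?_⟩
  rw [graphOver, graphOver, ← hpi, Set.image_image, Set.image_image]
  exact Set.image_congr fun x _ => hφ x

theorem exists_perm_mem_iff {ι : Type*} [Finite ι] {A B : Finset ι} (h : #A = #B) :
    ∃ σ : Equiv.Perm ι, ∀ i, σ i ∈ A ↔ i ∈ B := by
  classical
  let e : {i // i ∈ B} ≃ {i // i ∈ A} := (equivOfCardEq h).symm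
  exact ⟨e.extendSubtype, fun i =>
    ⟨not_imp_not.1 (e.extendSubtype_not_mem i), e.extendSubtype_mem i⟩⟩

theorem card_filter_val_add_le {m : ℕ} (hm : 1 ≤ m) :
    #{i : Fin n | i.val + m ≤ n} = n + 1 - m := by
  rw [filter_congr fun i _ => (by omega : i.val + m ≤ n ↔ i.val < n + 1 - m),
    Fin.card_filter_val_lt]
  omega

end Congruence

section Cylinder

variable {n r : ℕ} {M : Set (EuclideanSpace ℝ (Fin (n + 1)))}

theorem cylinderFun_eq_translationFun (hn : n ≠ 0) (a : Fin n → ℝ) (f : Fin n → ℝ → ℝ) (b : ℝ) :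
    cylinderFun r a f b =
      translationFun fun i t => (if i.val + r ≤ n then a i * t else f i t) + b / n := by
  funext x
  rw [translationFun_add_const_div hn fun i t => if i.val + r ≤ n then a i * t else f i t]
  simp only [cylinderFun, translationFun, sum_ite, not_le]

theorem isCylinderGraph_iff (hn : n ≠ 0) :
    IsCylinderGraph r M ↔ ∃ (K : Fin n → Set ℝ) (f : Fin n → ℝ → ℝ),
      (∀ i, IsOpenInterval (K i)) ∧ (∀ i, ContDiffOn ℝ ∞ (f i) (K i)) ∧
      (∀ i : Fin n, i.val + r ≤ n → ∃ a, IsAffineOn a (f i) (K i)) ∧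
      M = graphOver (translationFun f) (Set.univ.pi K) := by
  constructor
  · rintro ⟨K, a, f, b, hK, hf, rfl⟩
    have haff : ∀ i : Fin n, i.val + r ≤ n → IsAffineOn (a i)
        (fun t => (if i.val + r ≤ n then a i * t else f i t) + b / n) (K i) :=
      fun i hi => ⟨b / n, fun t _ => by simp only [if_pos hi]⟩
    refine ⟨K, _, hK, fun i => ?_, fun i hi => ⟨a i, haff i hi⟩,
      by rw [cylinderFun_eq_translationFun hn]⟩
    by_cases hi : i.val + r ≤ n
    · exact (haff i hi).contDiffOn
    · simp only [if_neg hi]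
      exact (hf i (not_le.1 hi)).add contDiffOn_const
  · rintro ⟨K, f, hK, hf, haff, rfl⟩
    choose! a d had using haff
    refine ⟨K, a, f, ∑ i with i.val + r ≤ n, d i, hK, fun j _ => hf j,
      graphOver_congr fun x hx => ?_⟩
    rw [translationFun, cylinderFun, add_right_comm, ← sum_add_distrib,
      ← sum_filter_add_sum_filter_not univ fun i : Fin n => i.val + r ≤ n]
    simp only [not_le]
    congr 1
    exact sum_congr rfl fun i hi => had i (mem_filter.1 hi).2 _ (hx i (Set.mem_univ i))

theorem exists_areCongruent_isCylinderGraph (hr : 1 ≤ r) (hrn : r ≤ n) {J : Fin n → Set ℝ}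
    (hJ : ∀ i, IsOpenInterval (J i)) {f : Fin n → ℝ → ℝ} (hf : ∀ i, ContDiffOn ℝ ∞ (f i) (J i))
    {A : Finset (Fin n)} (hA : #A < r) (haff : ∀ i ∉ A, ∃ a, IsAffineOn a (f i) (J i)) :
    ∃ M, AreCongruent (graphOver (translationFun f) (Set.univ.pi J)) M ∧ IsCylinderGraph r M := by
  obtain ⟨B, hAB, hB⟩ := exists_superset_card_eq (n := r - 1) (s := A) (by omega)
    (by rw [Fintype.card_fin]; omega)
  obtain ⟨σ, hσ⟩ := exists_perm_mem_iff (A := B)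
    (B := ({i : Fin n | i.val + r ≤ n} : Finset (Fin n))ᶜ) (by
      rw [hB, card_compl, card_filter_val_add_le hr, Fintype.card_fin]
      omega)
  refine ⟨_, areCongruent_graphOver_comp_perm σ f J, (isCylinderGraph_iff (by omega)).2
    ⟨_, _, fun i => hJ (σ i), fun i => hf (σ i), fun i hi => haff _ fun hσA => ?_, rfl⟩⟩
  exact mem_compl.1 ((hσ i).1 (hAB hσA)) (mem_filter_univ i |>.2 hi)

end Cylinder

section Enneper

open Real

variable {n r : ℕ} {a b : Fin n → ℝ} {K : Fin n → Set ℝ} {f : Fin n → ℝ → ℝ}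
  {M : Set (EuclideanSpace ℝ (Fin (n + 1)))}

theorem lastIdx_notMem_cosIdx (h : r < n) : lastIdx h ∉ cosIdx n r := by
  simp only [cosIdx, lastIdx, mem_filter_univ]
  omega

theorem compl_affineIdx (h : r < n) : (affineIdx n r)ᶜ = insert (lastIdx h) (cosIdx n r) := by
  ext i
  have := i.isLt
  simp only [affineIdx, cosIdx, lastIdx, mem_compl, mem_insert, mem_filter_univ, Fin.ext_iff]
  omega

theorem card_compl_affineIdx (h : r < n) : #(affineIdx n r)ᶜ = r + 1 := by
  have := card_filter_val_add_le (n := n) (m := r + 2) (by omega)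
  rw [card_compl, affineIdx, Fintype.card_fin,
    filter_congr fun i _ => (by omega : i.val + r + 1 < n ↔ i.val + (r + 2) ≤ n), this]
  omega

theorem elemSymm_cosIdx (hr : 1 ≤ r) (h : r < n) (ha : ∀ k ∈ cosIdx n r, a k ≠ 0) :
    elemSymm (r - 1) (cosIdx n r) a =
      (∏ k ∈ cosIdx n r, a k) * ∑ k ∈ cosIdx n r, (a k)⁻¹ := by
  refine esymmOn_eq_prod_mul_sum_inv ?_ ha
  have := card_compl_affineIdx h
  rw [compl_affineIdx h, card_insert_of_notMem (lastIdx_notMem_cosIdx h)] at this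
  omega

theorem enneperSlope_eq (hr : 1 ≤ r) (h : r < n) (ha : ∀ k ∈ cosIdx n r, a k ≠ 0) :
    enneperSlope r a = -(∑ k ∈ cosIdx n r, (a k)⁻¹)⁻¹ := by
  rw [enneperSlope, elemSymm_cosIdx hr h ha, div_mul_cancel_left₀ (prod_ne_zero_iff.2 ha)]

/-- The coefficients of all the variables of `enneperFun h a b c`: those in `a`, except that the
one of the last variable is `enneperSlope r a`. -/
def enneperCoeff (h : r < n) (a : Fin n → ℝ) : Fin n → ℝ :=
  update a (lastIdx h) (enneperSlope r a)

/-- The `i`-th summand of `enneperFun`, up to an additive constant, in terms of the coefficients `a`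
of all the variables. -/
def enneperSummand (r : ℕ) (a b : Fin n → ℝ) (i : Fin n) (t : ℝ) : ℝ :=
  if i ∈ affineIdx n r then a i * t
  else -(a i)⁻¹ * log (cos (a i * √(enneperBeta r a) * t + b i))

theorem enneperCoeff_lastIdx (h : r < n) : enneperCoeff h a (lastIdx h) = enneperSlope r a :=
  update_self ..

theorem enneperCoeff_of_mem_affineIdx (h : r < n) {i : Fin n} (hi : i ∈ affineIdx n r) :
    enneperCoeff h a i = a i :=
  update_of_ne (fun hil => notMem_compl.2 hi <| by
    rw [compl_affineIdx h, hil]; exact mem_insert_self _ _) _ _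

theorem enneperCoeff_of_mem_cosIdx (h : r < n) {i : Fin n} (hi : i ∈ cosIdx n r) :
    enneperCoeff h a i = a i :=
  update_of_ne (ne_of_mem_of_not_mem hi (lastIdx_notMem_cosIdx h)) _ _

theorem forall_notMem_affineIdx (h : r < n) {p : Fin n → Prop} :
    (∀ i ∉ affineIdx n r, p i) ↔ p (lastIdx h) ∧ ∀ k ∈ cosIdx n r, p k := by
  simp only [← mem_compl, compl_affineIdx h, forall_mem_insert]

theorem forall_enneperCoeff_iff (h : r < n) {p : Fin n → ℝ → Prop} :
    (∀ i ∉ affineIdx n r, p i (enneperCoeff h a i)) ↔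
      p (lastIdx h) (enneperSlope r a) ∧ ∀ k ∈ cosIdx n r, p k (a k) := by
  rw [forall_notMem_affineIdx h, enneperCoeff_lastIdx]
  exact and_congr_right' <| forall₂_congr fun k hk => by rw [enneperCoeff_of_mem_cosIdx h hk]

theorem enneperBeta_enneperCoeff (h : r < n) :
    enneperBeta r (enneperCoeff h a) = enneperBeta r a :=
  congrArg (1 + ·) <| sum_congr rfl fun i hi => by rw [enneperCoeff_of_mem_affineIdx h hi]

theorem sum_inv_enneperCoeff (hr : 1 ≤ r) (h : r < n) (ha : ∀ k ∈ cosIdx n r, a k ≠ 0) :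
    ∑ i ∈ (affineIdx n r)ᶜ, (enneperCoeff h a i)⁻¹ = 0 := by
  have hcos : ∑ k ∈ cosIdx n r, (enneperCoeff h a k)⁻¹ = ∑ k ∈ cosIdx n r, (a k)⁻¹ :=
    sum_congr rfl fun k hk => by rw [enneperCoeff_of_mem_cosIdx h hk]
  rw [compl_affineIdx h, sum_insert (lastIdx_notMem_cosIdx h), enneperCoeff_lastIdx,
    enneperSlope_eq hr h ha, hcos, inv_neg, inv_inv, neg_add_cancel]

theorem sum_inv_cosIdx (h : r < n) (hsum : ∑ i ∈ (affineIdx n r)ᶜ, (a i)⁻¹ = 0) :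
    ∑ k ∈ cosIdx n r, (a k)⁻¹ = -(a (lastIdx h))⁻¹ := by
  rwa [compl_affineIdx h, sum_insert (lastIdx_notMem_cosIdx h), add_comm,
    add_eq_zero_iff_eq_neg] at hsum

theorem enneperCoeff_eq_self (hr : 1 ≤ r) (h : r < n) (ha : ∀ k ∈ cosIdx n r, a k ≠ 0)
    (hsum : ∑ i ∈ (affineIdx n r)ᶜ, (a i)⁻¹ = 0) : enneperCoeff h a = a := by
  rw [enneperCoeff, enneperSlope_eq hr h ha, sum_inv_cosIdx h hsum, inv_neg, neg_neg, inv_inv,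
    update_eq_self]

-- The logarithm of the last cosine occurs with total coefficient `∑ (a k)⁻¹ = -(slope)⁻¹`.
theorem enneperFun_eq_translationFun_add (hr : 1 ≤ r) (h : r < n)
    (ha : ∀ k ∈ cosIdx n r, a k ≠ 0) (c : ℝ) {x : Fin n → ℝ}
    (hx : ∀ i ∉ affineIdx n r,
      |enneperCoeff h a i * √(enneperBeta r a) * x i + b i| < π / 2) :
    enneperFun h a b c x = translationFun (enneperSummand r (enneperCoeff h a) b) x + c := by
  obtain ⟨hlast, hx⟩ := (forall_enneperCoeff_iff h (p := fun i s =>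
    |s * √(enneperBeta r a) * x i + b i| < π / 2)).1 hx
  set L := log (cos (enneperSlope r a * √(enneperBeta r a) * x (lastIdx h) + b (lastIdx h))) with hL
  have hnot : ∀ {i}, i ∈ insert (lastIdx h) (cosIdx n r) → i ∉ affineIdx n r := fun hi => by
    rwa [← mem_compl, compl_affineIdx h]
  have haff : ∀ i ∈ affineIdx n r,
      a i * x i = enneperSummand r (enneperCoeff h a) b i (x i) := fun i hi => by
    rw [enneperSummand, if_pos hi, enneperCoeff_of_mem_affineIdx h hi]
  have hcos : ∀ k ∈ cosIdx n r, 1 / a k * log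
      |cos (enneperSlope r a * √(enneperBeta r a) * x (lastIdx h) + b (lastIdx h)) /
        cos (a k * √(enneperBeta r a) * x k + b k)| =
      (a k)⁻¹ * L + enneperSummand r (enneperCoeff h a) b k (x k) := fun k hk => by
    rw [enneperSummand, if_neg (hnot (mem_insert_of_mem hk)), enneperBeta_enneperCoeff,
      enneperCoeff_of_mem_cosIdx h hk, log_abs,
      log_div (cos_pos_of_abs_lt hlast).ne' (cos_pos_of_abs_lt (hx k hk)).ne', ← hL]
    ring
  have hsummand : enneperSummand r (enneperCoeff h a) b (lastIdx h) (x (lastIdx h)) =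
      (∑ k ∈ cosIdx n r, (a k)⁻¹) * L := by
    rw [enneperSummand, if_neg (hnot (mem_insert_self _ _)), enneperBeta_enneperCoeff,
      enneperCoeff_lastIdx, ← hL, enneperSlope_eq hr h ha, inv_neg, inv_inv, neg_neg]
  rw [enneperFun, translationFun, sum_congr rfl haff, sum_congr rfl hcos, sum_add_distrib,
    ← sum_mul, ← sum_add_sum_compl (affineIdx n r), compl_affineIdx h,
    sum_insert (lastIdx_notMem_cosIdx h), hsummand]

theorem isEnneperProfile_compl_affineIdx_iff :
    IsEnneperProfile (affineIdx n r)ᶜ a K f ↔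
      (∀ i ∉ affineIdx n r, a i ≠ 0) ∧ ∑ i ∈ (affineIdx n r)ᶜ, (a i)⁻¹ = 0 ∧
      ∃ b d : Fin n → ℝ,
        (∀ i ∉ affineIdx n r, ∀ t ∈ K i, |a i * √(enneperBeta r a) * t + b i| < π / 2) ∧
        ∀ i, ∀ t ∈ K i, f i t = enneperSummand r a b i t + d i := by
  constructor
  · intro hf
    choose! d hd using hf.isAffineOn
    choose! b d' hlog using hf.isLogCosOn
    simp only [mem_compl] at hlog
    rw [compl_compl, ← enneperBeta] at hlog
    refine ⟨fun i hi => hf.ne_zero i (mem_compl.2 hi), hf.sum_inv_eq_zero, b,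
      fun i => if i ∈ affineIdx n r then d i else d' i, fun i hi t ht => (hlog i hi t ht).1,
      fun i t ht => ?_⟩
    beta_reduce
    by_cases hi : i ∈ affineIdx n r
    · rw [enneperSummand, if_pos hi, if_pos hi, hd i (notMem_compl.2 hi) t ht]
    · rw [enneperSummand, if_neg hi, if_neg hi, (hlog i hi t ht).2]
  · rintro ⟨hne, hsum, b, d, hbound, hf⟩
    refine ⟨fun i hi => hne i (mem_compl.1 hi), hsum, fun i hi => ⟨d i, fun t ht => ?_⟩,
      fun i hi => ⟨b i, d i, fun t ht => ?_⟩⟩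
    · rw [hf i t ht, enneperSummand, if_pos (notMem_compl.1 hi)]
    · rw [compl_compl, ← enneperBeta]
      exact ⟨hbound i (mem_compl.1 hi) t ht, by
        rw [hf i t ht, enneperSummand, if_neg (mem_compl.1 hi)]⟩

theorem IsEnneperGraph.exists_isEnneperProfile (hr : 1 ≤ r) {h : r < n}
    (hM : IsEnneperGraph h M) :
    ∃ K a f, (∀ i, IsOpenInterval (K i)) ∧ IsEnneperProfile (affineIdx n r)ᶜ a K f ∧
      M = graphOver (translationFun f) (Set.univ.pi K) := by
  obtain ⟨K, a, b, c, hK, ha, hσ, hcos, hlast, rfl⟩ := hM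
  have hbound : ∀ i ∉ affineIdx n r, ∀ t ∈ K i,
      |enneperCoeff h a i * √(enneperBeta r a) * t + b i| < π / 2 :=
    (forall_enneperCoeff_iff h (p := fun i s => ∀ t ∈ K i,
      |s * √(enneperBeta r a) * t + b i| < π / 2)).2 ⟨hlast, hcos⟩
  have hslope : enneperSlope r a ≠ 0 := neg_ne_zero.2 (div_ne_zero (prod_ne_zero_iff.2 ha) hσ)
  refine ⟨K, enneperCoeff h a, fun i t => enneperSummand r (enneperCoeff h a) b i t + c / n, hK,
    isEnneperProfile_compl_affineIdx_iff.2
      ⟨(forall_enneperCoeff_iff h (p := fun _ s => s ≠ 0)).2 ⟨hslope, ha⟩,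
        sum_inv_enneperCoeff hr h ha, b, fun _ => c / n, ?_, fun _ _ _ => rfl⟩,
    graphOver_congr fun x hx => ?_⟩
  · rwa [enneperBeta_enneperCoeff]
  · rw [enneperFun_eq_translationFun_add hr h ha c fun i hi => hbound i hi _ (hx i trivial),
      translationFun_add_const_div (by omega)]

theorem IsEnneperProfile.isEnneperGraph (hr : 1 ≤ r) (h : r < n)
    (hK : ∀ i, IsOpenInterval (K i)) (hf : IsEnneperProfile (affineIdx n r)ᶜ a K f) :
    IsEnneperGraph h (graphOver (translationFun f) (Set.univ.pi K)) := by
  obtain ⟨hne, hsum, b, d, hbound, hfd⟩ := isEnneperProfile_compl_affineIdx_iff.1 hf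
  obtain ⟨hlast, ha⟩ := (forall_notMem_affineIdx h).1 hne
  have hself : enneperCoeff h a = a := enneperCoeff_eq_self hr h ha hsum
  have hbound' := hbound
  rw [← hself, enneperBeta_enneperCoeff] at hbound'
  obtain ⟨hlastK, hcosK⟩ := (forall_enneperCoeff_iff h (p := fun i s => ∀ t ∈ K i,
    |s * √(enneperBeta r a) * t + b i| < π / 2)).1 hbound'
  refine ⟨K, a, b, ∑ i, d i, hK, ha, ?_, hcosK, hlastK, graphOver_congr fun x hx => ?_⟩
  · rw [elemSymm_cosIdx hr h ha, sum_inv_cosIdx h hsum]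
    exact mul_ne_zero (prod_ne_zero_iff.2 ha) (neg_ne_zero.2 (inv_ne_zero hlast))
  · rw [enneperFun_eq_translationFun_add hr h ha _ fun i hi => hbound' i hi _ (hx i trivial),
      hself, translationFun, translationFun, ← sum_add_distrib]
    exact sum_congr rfl fun i _ => hfd i _ (hx i trivial)

theorem IsEnneperProfile.exists_areCongruent_isEnneperGraph (hr : 1 ≤ r) (h : r < n)
    (hK : ∀ i, IsOpenInterval (K i)) {A : Finset (Fin n)} (hA : #A = r + 1)
    (hf : IsEnneperProfile A a K f) :
    ∃ M, AreCongruent (graphOver (translationFun f) (Set.univ.pi K)) M ∧ IsEnneperGraph h M := by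
  obtain ⟨σ, hσ⟩ := exists_perm_mem_iff (hA.trans (card_compl_affineIdx h).symm)
  exact ⟨_, areCongruent_graphOver_comp_perm σ f K,
    (hf.comp_perm hσ).isEnneperGraph hr h fun i => hK (σ i)⟩

end Enneper

section Classification

variable {n r : ℕ} {M : Set (EuclideanSpace ℝ (Fin (n + 1)))}

theorem contDiffAt_two_of_contDiffOn {J : Set ℝ} {f : ℝ → ℝ} (hJ : IsOpen J)
    (hf : ContDiffOn ℝ ∞ f J) {t : ℝ} (ht : t ∈ J) : ContDiffAt ℝ 2 f t :=
  (hf.contDiffAt (hJ.mem_nhds ht)).of_le ENat.LEInfty.out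

theorem IsCylinderGraph.exists_graphCurvature_eq_zero (hr : 1 ≤ r) (h : r < n)
    (hM : IsCylinderGraph r M) :
    ∃ K g, M = graphOver (translationFun g) (Set.univ.pi K) ∧
      ∀ y ∈ Set.univ.pi K, ContDiffAt ℝ 2 (translationFun g) y ∧
        graphCurvature r (translationFun g) y = 0 := by
  obtain ⟨K, g, hK, hg, haff, hM⟩ := (isCylinderGraph_iff (by omega)).1 hM
  have hg2 : ∀ i, ∀ t ∈ K i, ContDiffAt ℝ 2 (g i) t := fun i _ =>
    contDiffAt_two_of_contDiffOn (hK i).1 (hg i)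
  have hcard : #({i : Fin n | i.val + r ≤ n} : Finset (Fin n))ᶜ < r := by
    rw [card_compl, card_filter_val_add_le hr, Fintype.card_fin]
    omega
  refine ⟨K, g, hM, fun y hy => ⟨contDiffAt_translationFun fun i => hg2 i _ (hy i trivial),
    graphCurvature_eq_zero_of_card_lt h (fun i => (hK i).1) hg2 hcard (fun i hi => haff i ?_) hy⟩⟩
  exact (mem_filter_univ i).1 (notMem_compl.1 hi)

theorem IsEnneperGraph.exists_graphCurvature_eq_zero (hr : 1 ≤ r) {h : r < n}
    (hM : IsEnneperGraph h M) :
    ∃ K g, M = graphOver (translationFun g) (Set.univ.pi K) ∧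
      ∀ y ∈ Set.univ.pi K, ContDiffAt ℝ 2 (translationFun g) y ∧
        graphCurvature r (translationFun g) y = 0 := by
  obtain ⟨K, a, g, hK, hg, hM⟩ := hM.exists_isEnneperProfile hr
  exact ⟨K, g, hM, fun y hy => ⟨contDiffAt_translationFun fun i =>
      contDiffAt_two_of_contDiffOn (hK i).1 (hg.contDiffOn i) (hy i trivial),
    hg.graphCurvature_eq_zero h (card_compl_affineIdx h) (fun i => (hK i).1) hy⟩⟩

end Classification

end TranslationHypersurface

end

open TranslationHypersurface in
theorem theorem1_general (n r : ℕ) (hr : 1 ≤ r) (hrn : r < n)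
    (J : Fin n → Set ℝ) (hJ : ∀ i, IsOpenInterval (J i))
    (f : Fin n → ℝ → ℝ) (hf : ∀ i, ContDiffOn ℝ ∞ (f i) (J i)) :
    (∀ x ∈ Set.univ.pi J, graphCurvature r (translationFun f) x = 0) ↔
    ∃ M' : Set (EuclideanSpace ℝ (Fin (n + 1))),
      AreCongruent (graphOver (translationFun f) (Set.univ.pi J)) M' ∧
      (IsCylinderGraph r M' ∨ IsEnneperGraph hrn M') := by
  have hf2 : ∀ i, ∀ t ∈ J i, ContDiffAt ℝ 2 (f i) t := fun i _ =>
    contDiffAt_two_of_contDiffOn (hJ i).1 (hf i)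
  constructor
  · intro hzero
    rcases (forall_graphCurvature_translationFun_eq_zero_iff hrn hJ hf2).1 hzero with
      ⟨A, hA, haff⟩ | ⟨A, a, hA, hprofile⟩
    · exact (exists_areCongruent_isCylinderGraph hr hrn.le hJ hf hA haff).imp
        fun _ hM => hM.imp_right Or.inl
    · exact (hprofile.exists_areCongruent_isEnneperGraph hr hrn hJ hA).imp
        fun _ hM => hM.imp_right Or.inr
  · rintro ⟨_, ⟨φ, hφ⟩, hM⟩ x hx
    obtain ⟨K, g, rfl, hg⟩ := hM.elim (fun hM => hM.exists_graphCurvature_eq_zero hr hrn)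
      fun hM => hM.exists_graphCurvature_eq_zero hr
    exact graphCurvature_eq_zero_of_isometry hrn.le
      (isOpen_set_pi Set.finite_univ fun i _ => (hJ i).1)
      (fun y hy => contDiffAt_translationFun fun i => hf2 i _ (hy i trivial))
      (fun y hy => (hg y hy).1) φ hφ.subset (fun y hy => (hg y hy).2) hx

theorem theorem1 (n r : ℕ) (hn : 3 ≤ n) (hr : 2 < r) (hrn : r < n)
    (J : Fin n → Set ℝ) (hJ : ∀ i, TranslationHypersurface.IsOpenInterval (J i))
    (f : Fin n → ℝ → ℝ) (hf : ∀ i, ContDiffOn ℝ ∞ (f i) (J i)) :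
    (∀ x ∈ Set.univ.pi J,
      TranslationHypersurface.graphCurvature r (TranslationHypersurface.translationFun f) x = 0) ↔
    ∃ M' : Set (EuclideanSpace ℝ (Fin (n + 1))),
      TranslationHypersurface.AreCongruent
        (TranslationHypersurface.graphOver (TranslationHypersurface.translationFun f)
          (Set.univ.pi J)) M' ∧
      (TranslationHypersurface.IsCylinderGraph r M' ∨
        TranslationHypersurface.IsEnneperGraph hrn M') :=
  theorem1_general n r (by omega) hrn J hJ f hf
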